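/- Let $0<\alpha<1$, and for $\beta,z\in\mathbb C$ let $E_{\alpha,\beta}(z)=\sum_{k=0}^\infty \frac{z^k}{\Gamma(\alpha k+\beta)}$ and $E_\alpha=E_{\alpha,1}$. All complex powers and arguments are principal, with $\arg z\in(-\pi,\pi]$. For $0<\theta<\pi$ let $\gamma(1,\theta)$ be the contour consisting of the ray $\arg z=-\theta$, $|z|\ge 1$, the arc $|z|=1$, $-\theta\le\arg z\le\theta$, and the ray $\arg z=\theta$, $|z|\ge1$. Let $\lambda\in\mathbb C\setminus\{0\}$, $\frac{\alpha\pi}{2}<\theta<\alpha\pi$ and $\theta_0\in(0,\theta-\frac{\alpha\pi}{2})$ be such that $|\theta-|\arg\lambda||\ge\theta_0$. Then the following arc length integrals converge, so that the constants $$m(\alpha,\lambda)=\max\left\{\frac{\int_{\gamma(1,\theta)}|\exp(\zeta^{1/\alpha})|\,|d\zeta|}{2\alpha\pi|\lambda|\sin\theta_0},\ \frac{\int_{\gamma(1,\theta)}|\exp(\zeta^{1/\alpha})\zeta^{1/\alpha}|\,|d\zeta|}{2\alpha|\lambda|^2\sin\theta_0}\right\},\qquad t_0=\frac{1}{|\lambda|^{1/\alpha}(1-\sin\theta_0)^{1/\alpha}}$$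 (where $m(\alpha,\lambda)$ depends also on $\theta,\theta_0$, and $t_0$ on $\alpha,\lambda,\theta_0$) are well defined, and for every real $t\ge t_0$ the following hold. (i) If $|\arg\lambda|<\frac{\alpha\pi}{2}$, then $\left|E_\alpha(\lambda t^\alpha)-\frac1\alpha\exp(\lambda^{1/\alpha}t)\right|\le\frac{m(\alpha,\lambda)}{t^\alpha}$. (ii) If $|\arg\lambda|<\frac{\alpha\pi}{2}$, then $\left|t^{\alpha-1}E_{\alpha,\alpha}(\lambda t^\alpha)-\frac1\alpha\lambda^{\frac1\alpha-1}\exp(\lambda^{1/\alpha}t)\right|\le\frac{m(\alpha,\lambda)}{t^{\alpha+1}}$. (iii) If $\theta<|\arg\lambda|\le\pi$, then $\left|t^{\alpha-1}E_{\alpha,\alpha}(\lambda t^\alpha)\right|\le\frac{m(\alpha,\lambda)}{t^{\alpha+1}}$. -/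

import Mathlib

open Set MeasureTheory

noncomputable section

/-- The two-parameter Mittag-Leffler function `E_{α,β}(z) = ∑ₖ zᵏ / Γ(αk + β)`. -/
def mittagLeffler (α : ℝ) (β z : ℂ) : ℂ :=
  ∑' k : ℕ, z ^ k / Complex.Gamma ((α : ℂ) * (k : ℂ) + β)

/-- The point of the complex plane with polar coordinates `r` and `φ`. -/
def polarPoint (r φ : ℝ) : ℂ := (r : ℂ) * Complex.exp ((φ : ℂ) * Complex.I)

/-- Absolute convergence of the arc length integral of `g` over the contour `γ(ε, θ)`, which
consists of the ray `arg z = -θ, |z| ≥ ε`, the arc `|z| = ε, -θ ≤ arg z ≤ θ`, and the ray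
`arg z = θ, |z| ≥ ε`. -/
def ContourIntegrable (ε θ : ℝ) (g : ℂ → ℝ) : Prop :=
  IntegrableOn (fun r : ℝ => g (polarPoint r (-θ))) (Ioi ε) ∧
  IntervalIntegrable (fun φ : ℝ => g (polarPoint ε φ) * ε) volume (-θ) θ ∧
  IntegrableOn (fun r : ℝ => g (polarPoint r θ)) (Ioi ε)

/-- The arc length integral `∫_{γ(ε, θ)} g(ζ) |dζ|`, as the sum over the three parts of the
contour: on the rays `|dζ| = dr`, on the arc `|dζ| = ε dφ`. -/
def contourIntegral (ε θ : ℝ) (g : ℂ → ℝ) : ℝ :=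
  (∫ r in Ioi ε, g (polarPoint r (-θ))) +
  (∫ φ in (-θ)..θ, g (polarPoint ε φ) * ε) +
  (∫ r in Ioi ε, g (polarPoint r θ))

/-- `|exp(ζ^{1/α})|`, with the principal branch of the power. -/
def absExpRoot (α : ℝ) (ζ : ℂ) : ℝ :=
  ‖Complex.exp (ζ ^ ((1 / α : ℝ) : ℂ))‖

/-- `|exp(ζ^{1/α}) ζ^{1/α}|`, with the principal branch of the power. -/
def absExpRootMul (α : ℝ) (ζ : ℂ) : ℝ :=
  ‖Complex.exp (ζ ^ ((1 / α : ℝ) : ℂ)) * ζ ^ ((1 / α : ℝ) : ℂ)‖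

/-- The constant `m(α, λ)`, which also depends on the angles `θ` and `θ₀`. -/
def mConst (α θ θ₀ : ℝ) (lam : ℂ) : ℝ :=
  max (contourIntegral 1 θ (absExpRoot α) / (2 * α * Real.pi * ‖lam‖ * Real.sin θ₀))
    (contourIntegral 1 θ (absExpRootMul α) / (2 * α * ‖lam‖ ^ 2 * Real.sin θ₀))

/-- The time `t₀ = 1 / (|λ|^{1/α} (1 - sin θ₀)^{1/α})`. -/
def tZero (α θ₀ : ℝ) (lam : ℂ) : ℝ :=
  1 / (‖lam‖ ^ (1 / α) * (1 - Real.sin θ₀) ^ (1 / α))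

end

/-! ### Cauchy's theorem on rectangles and half strips. -/

section ContourTools

open Complex Filter Topology

/-! The substitution `ζ = exp (α w)` turns `γ(1, θ)` into the boundary of the half strip `re w > 0`,
`|im w| < φ`, where `θ = α φ` and `π/2 < φ < π`. There `ζ^{1/α} = exp w`, and every integrand
becomes entire or meromorphic, so only Cauchy's theorem on rectangles is needed. Hankel's formula
`stripIntegral_hankelKernel` writes `1/Γ(αk+β)` as an integral over such a boundary. If the vertical
side lies far enough to the right, the series of `E_{α,β}(z)` sums under the integral to the kernel
`exp(e^w + (1-β)w) e^{αw} / (e^{αw} - z)`. Moving the side back to `re w = 0` crosses the pole `w =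
log z / α` exactly when `z` is to the right of the contour; its residue is the exponential term
(`stripIntegral_mittagLefflerKernel_of_abs_arg_lt`,
`stripIntegral_mittagLefflerKernel_of_lt_abs_arg`). The remaining integral is the error. With `z = λ
t^α`, the separation of the angles on the rays and `t ≥ t₀` on the arc give `|ζ - z| ≥ |z| sin θ₀`
(`norm_mul_sin_le_norm_exp_sub`), so the error is `O(1/|z|)`. For `β = α`, write `1/(ζ-z) = -1/z +
ζ/(z(ζ-z))`: the first term integrates to a multiple of "`1/Γ(0)`" `= 0`, which improves the error
to `O(1/|z|²)`. -/

/-- The counterclockwise integral of `F` over the boundary of `[a, b] × [c, d]`. -/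
noncomputable def rectIntegral (a b c d : ℝ) (F : ℂ → ℂ) : ℂ :=
  (∫ x : ℝ in a..b, F (x + c * I)) - (∫ x : ℝ in a..b, F (x + d * I)) +
    I * (∫ y : ℝ in c..d, F (b + y * I)) - I * ∫ y : ℝ in c..d, F (a + y * I)

theorem rectIntegral_eq_zero {a b c d : ℝ} {F : ℂ → ℂ} (hab : a ≤ b) (hcd : c ≤ d)
    (hF : DifferentiableOn ℂ F (Icc a b ×ℂ Icc c d)) : rectIntegral a b c d F = 0 := by
  have := integral_boundary_rect_eq_zero_of_differentiableOn F ⟨a, c⟩ ⟨b, d⟩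
    (by simpa [uIcc_of_le, hab, hcd] using hF)
  simpa [rectIntegral] using this

theorem log_sub_log_neg_of_im_pos {z : ℂ} (hz : 0 < z.im) :
    log z - log (-z) = Real.pi * I := by
  simp only [log, norm_neg, arg_neg_eq_arg_sub_pi_of_im_pos hz]
  push_cast; ring

theorem log_sub_log_neg_of_im_neg {z : ℂ} (hz : z.im < 0) :
    log z - log (-z) = -(Real.pi * I) := by
  simp only [log, norm_neg, arg_neg_eq_arg_add_pi_of_im_neg hz]
  push_cast; ring

theorem intervalIntegral_inv_horizontal {a b c : ℝ} {w : ℂ}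
    (h : ∀ x ∈ uIcc a b, ((x : ℂ) + c * I - w) ∈ slitPlane) :
    ∫ x : ℝ in a..b, ((x : ℂ) + c * I - w)⁻¹ =
      log ((b : ℂ) + c * I - w) - log ((a : ℂ) + c * I - w) := by
  refine intervalIntegral.integral_eq_sub_of_hasDerivAt
    (f := fun x : ℝ => log ((x : ℂ) + c * I - w)) (fun x hx => ?_) ?_
  · have h1 : HasDerivAt (fun x : ℝ => (x : ℂ) + c * I - w) 1 x :=
      ((hasDerivAt_id x).ofReal_comp.add_const _).sub_const _
    simpa using h1.clog_real (h x hx)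
  · refine ContinuousOn.intervalIntegrable (ContinuousOn.inv₀ (by fun_prop) ?_)
    exact fun x hx => slitPlane_ne_zero (h x hx)

theorem intervalIntegral_inv_vertical {a c d : ℝ} {w : ℂ}
    (h : ∀ y ∈ uIcc c d, ((a : ℂ) + y * I - w) ∈ slitPlane) :
    I * ∫ y : ℝ in c..d, ((a : ℂ) + y * I - w)⁻¹ =
      log ((a : ℂ) + d * I - w) - log ((a : ℂ) + c * I - w) := by
  rw [← intervalIntegral.integral_const_mul]
  refine intervalIntegral.integral_eq_sub_of_hasDerivAt
    (f := fun y : ℝ => log ((a : ℂ) + y * I - w)) (fun y hy => ?_) ?_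
  · have h1 : HasDerivAt (fun y : ℝ => (a : ℂ) + y * I - w) (1 * I) y :=
      (((hasDerivAt_id y).ofReal_comp.mul_const I).const_add _).sub_const _
    simpa [div_eq_mul_inv] using h1.clog_real (h y hy)
  · refine ContinuousOn.intervalIntegrable (ContinuousOn.mul (by fun_prop)
      (ContinuousOn.inv₀ (by fun_prop) ?_))
    exact fun x hx => slitPlane_ne_zero (h x hx)

/-- The left side crosses the cut of `log`, so the primitive is `log (-·)`. -/
theorem intervalIntegral_inv_vertical_left {a c d : ℝ} {w : ℂ} (ha : a < w.re) :
    I * ∫ y : ℝ in c..d, ((a : ℂ) + y * I - w)⁻¹ =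
      log (-((a : ℂ) + d * I - w)) - log (-((a : ℂ) + c * I - w)) := by
  rw [← intervalIntegral.integral_const_mul]
  have hs : ∀ y : ℝ, -((a : ℂ) + y * I - w) ∈ slitPlane := fun y => by
    left; simpa using ha
  refine intervalIntegral.integral_eq_sub_of_hasDerivAt
    (f := fun y : ℝ => log (-((a : ℂ) + y * I - w))) (fun y hy => ?_) ?_
  · have h1 : HasDerivAt (fun y : ℝ => -((a : ℂ) + y * I - w)) (-(1 * I)) y :=
      ((((hasDerivAt_id y).ofReal_comp.mul_const I).const_add _).sub_const _).neg
    have := h1.clog_real (hs y)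
    rwa [neg_div_neg_eq, one_mul, div_eq_mul_inv] at this
  · refine Continuous.intervalIntegrable (Continuous.mul (by fun_prop)
      (Continuous.inv₀ (by fun_prop) ?_)) _ _
    exact fun x => neg_ne_zero.mp (slitPlane_ne_zero (hs x))

/-- The primitives on the sides agree at the right corners. At the two left corners `log` meets `log
(-·)`, and each mismatch contributes `π i`. -/
theorem rectIntegral_inv_sub {a b c d : ℝ} {w : ℂ} (ha : a < w.re) (hb : w.re < b)
    (hc : c < w.im) (hd : w.im < d) :
    rectIntegral a b c d (fun z => (z - w)⁻¹) = 2 * Real.pi * I := by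
  unfold rectIntegral
  rw [intervalIntegral_inv_horizontal, intervalIntegral_inv_horizontal,
    intervalIntegral_inv_vertical, intervalIntegral_inv_vertical_left ha]
  · have h1 := log_sub_log_neg_of_im_pos (z := (a : ℂ) + d * I - w) (by simpa using hd)
    have h2 := log_sub_log_neg_of_im_neg (z := (a : ℂ) + c * I - w) (by simpa using hc)
    linear_combination h1 - h2
  · intro y _; left; simpa using hb
  · intro x _; right; simpa [sub_eq_zero] using hd.ne'
  · intro x _; right; simpa [sub_eq_zero] using hc.ne

/-- Cauchy's integral formula for a rectangle. -/
theorem rectIntegral_div_sub {a b c d : ℝ} {w : ℂ} {f : ℂ → ℂ} (ha : a < w.re) (hb : w.re < b)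
    (hc : c < w.im) (hd : w.im < d) (hf : DifferentiableOn ℂ f (Icc a b ×ℂ Icc c d)) :
    rectIntegral a b c d (fun z => f z / (z - w)) = 2 * Real.pi * I * f w := by
  have hnhds : Icc a b ×ℂ Icc c d ∈ 𝓝 w := by
    rw [← mem_interior_iff_mem_nhds, interior_reProdIm, interior_Icc, interior_Icc]
    exact ⟨⟨ha, hb⟩, hc, hd⟩
  -- The difference quotient extends holomorphically across `w`, so the singular part of the
  -- integrand is just `f w * (z - w)⁻¹`.
  have hds : DifferentiableOn ℂ (dslope f w) (Icc a b ×ℂ Icc c d) :=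
    (differentiableOn_dslope hnhds).2 hf
  have h0 := rectIntegral_eq_zero (ha.trans hb).le (hc.trans hd).le hds
  have h1 := rectIntegral_inv_sub ha hb hc hd
  have key : ∀ z, z ≠ w → f z / (z - w) = dslope f w z + f w * (z - w)⁻¹ := by
    intro z hz
    have := sub_ne_zero.2 hz
    rw [dslope_of_ne _ hz, slope_def_field]; field_simp; ring
  have hor : ∀ e : ℝ, e ∈ Icc c d → e ≠ w.im →
      ∫ x : ℝ in a..b, f (x + e * I) / (x + e * I - w) =
        (∫ x : ℝ in a..b, dslope f w (x + e * I)) + f w * ∫ x : ℝ in a..b, (x + e * I - w)⁻¹ := by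
    intro e he hew
    have hne : ∀ x : ℝ, (x : ℂ) + e * I ≠ w := fun x h => hew (by simp [← h])
    rw [← intervalIntegral.integral_const_mul, ← intervalIntegral.integral_add]
    · exact intervalIntegral.integral_congr fun x _ => key _ (hne x)
    · refine ContinuousOn.intervalIntegrable (hds.continuousOn.comp (by fun_prop) ?_)
      intro x hx
      rw [uIcc_of_le (ha.trans hb).le] at hx
      simpa [mem_reProdIm] using ⟨hx, he⟩
    · refine Continuous.intervalIntegrable (Continuous.mul (by fun_prop)
        (Continuous.inv₀ (by fun_prop) fun x => sub_ne_zero.2 (hne x))) _ _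
  have ver : ∀ e : ℝ, e ∈ Icc a b → e ≠ w.re →
      ∫ y : ℝ in c..d, f (e + y * I) / (e + y * I - w) =
        (∫ y : ℝ in c..d, dslope f w (e + y * I)) + f w * ∫ y : ℝ in c..d, (e + y * I - w)⁻¹ := by
    intro e he hew
    have hne : ∀ y : ℝ, (e : ℂ) + y * I ≠ w := fun x h => hew (by simp [← h])
    rw [← intervalIntegral.integral_const_mul, ← intervalIntegral.integral_add]
    · exact intervalIntegral.integral_congr fun x _ => key _ (hne x)
    · refine ContinuousOn.intervalIntegrable (hds.continuousOn.comp (by fun_prop) ?_)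
      intro x hx
      rw [uIcc_of_le (hc.trans hd).le] at hx
      simpa [mem_reProdIm] using ⟨he, hx⟩
    · refine Continuous.intervalIntegrable (Continuous.mul (by fun_prop)
        (Continuous.inv₀ (by fun_prop) fun x => sub_ne_zero.2 (hne x))) _ _
  unfold rectIntegral at h0 h1 ⊢
  rw [hor c (left_mem_Icc.2 (hc.trans hd).le) hc.ne, hor d (right_mem_Icc.2 (hc.trans hd).le) hd.ne',
    ver a (left_mem_Icc.2 (ha.trans hb).le) ha.ne, ver b (right_mem_Icc.2 (ha.trans hb).le) hb.ne']
  linear_combination h0 + f w * h1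

/-- The integral of `F` over the boundary of the half strip `{w | x₀ < re w, |im w| < φ}`, which
comes from infinity on the line `im w = -φ` and goes back on the line `im w = φ`. -/
noncomputable def stripIntegral (x₀ φ : ℝ) (F : ℂ → ℂ) : ℂ :=
  (∫ x : ℝ in Ioi x₀, F (x + φ * I)) - (∫ x : ℝ in Ioi x₀, F (x + (-φ : ℝ) * I)) +
    I * ∫ y : ℝ in (-φ)..φ, F (x₀ + y * I)

/-- Absolute convergence of `stripIntegral`. -/
def StripIntegrable (x₀ φ : ℝ) (F : ℂ → ℂ) : Prop :=
  IntegrableOn (fun x : ℝ => F (x + φ * I)) (Ioi x₀) ∧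
  IntegrableOn (fun x : ℝ => F (x + (-φ : ℝ) * I)) (Ioi x₀) ∧
  IntervalIntegrable (fun y : ℝ => F (x₀ + y * I)) volume (-φ) φ

/-- The boundary of the half strip `{w | x₀ < re w, |im w| < φ}`. -/
def stripBoundary (x₀ φ : ℝ) : Set ℂ :=
  {w | x₀ ≤ w.re ∧ |w.im| ≤ φ ∧ (w.re = x₀ ∨ |w.im| = φ)}

theorem ray_mem_stripBoundary {x₀ φ x : ℝ} (hφ : 0 ≤ φ) (hx : x₀ ≤ x) :
    (x + φ * I : ℂ) ∈ stripBoundary x₀ φ := by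
  simp [stripBoundary, hx, abs_of_nonneg hφ]

theorem ray_neg_mem_stripBoundary {x₀ φ x : ℝ} (hφ : 0 ≤ φ) (hx : x₀ ≤ x) :
    (x + (-φ : ℝ) * I : ℂ) ∈ stripBoundary x₀ φ := by
  simp [stripBoundary, hx, abs_of_nonneg hφ]

theorem segment_mem_stripBoundary {x₀ φ y : ℝ} (hy : y ∈ Icc (-φ) φ) :
    (x₀ + y * I : ℂ) ∈ stripBoundary x₀ φ := by
  simpa [stripBoundary] using abs_le.2 hy

theorem stripIntegral_congr {x₀ φ : ℝ} {F G : ℂ → ℂ} (hφ : 0 ≤ φ)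
    (h : ∀ w ∈ stripBoundary x₀ φ, F w = G w) :
    stripIntegral x₀ φ F = stripIntegral x₀ φ G := by
  unfold stripIntegral
  congr 1
  · congr 1
    · exact setIntegral_congr_fun measurableSet_Ioi fun x hx =>
        h _ (ray_mem_stripBoundary hφ (le_of_lt hx))
    · exact setIntegral_congr_fun measurableSet_Ioi fun x hx =>
        h _ (ray_neg_mem_stripBoundary hφ (le_of_lt hx))
  · congr 1
    refine intervalIntegral.integral_congr fun y hy => h _ (segment_mem_stripBoundary ?_)
    rwa [uIcc_of_le (by linarith)] at hy

theorem stripIntegral_add {x₀ φ : ℝ} {F G : ℂ → ℂ} (hF : StripIntegrable x₀ φ F)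
    (hG : StripIntegrable x₀ φ G) :
    stripIntegral x₀ φ (fun w => F w + G w) = stripIntegral x₀ φ F + stripIntegral x₀ φ G := by
  unfold stripIntegral
  rw [integral_add hF.1 hG.1, integral_add hF.2.1 hG.2.1, intervalIntegral.integral_add hF.2.2 hG.2.2]
  ring

theorem stripIntegral_const_mul {x₀ φ : ℝ} (F : ℂ → ℂ) (c : ℂ) :
    stripIntegral x₀ φ (fun w => c * F w) = c * stripIntegral x₀ φ F := by
  unfold stripIntegral
  rw [integral_const_mul, integral_const_mul, intervalIntegral.integral_const_mul]
  ring

theorem StripIntegrable.const_mul {x₀ φ : ℝ} {F : ℂ → ℂ} (hF : StripIntegrable x₀ φ F) (c : ℂ) :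
    StripIntegrable x₀ φ (fun w => c * F w) :=
  ⟨hF.1.const_mul c, hF.2.1.const_mul c, hF.2.2.const_mul c⟩

/-- Moving the vertical side of the half strip changes the integral by the integral over the
boundary of a rectangle. -/
theorem stripIntegral_eq_sub_rectIntegral {x₀ x₁ φ : ℝ} {F : ℂ → ℂ} (h : x₀ ≤ x₁)
    (hp : IntegrableOn (fun x : ℝ => F (x + φ * I)) (Ioi x₀))
    (hm : IntegrableOn (fun x : ℝ => F (x + (-φ : ℝ) * I)) (Ioi x₀)) :
    stripIntegral x₀ φ F = stripIntegral x₁ φ F - rectIntegral x₀ x₁ (-φ) φ F := by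
  have hsub : Ioi x₁ ⊆ Ioi x₀ := Ioi_subset_Ioi h
  have e1 := intervalIntegral.integral_interval_add_Ioi hp (hp.mono_set hsub)
  have e2 := intervalIntegral.integral_interval_add_Ioi hm (hm.mono_set hsub)
  unfold stripIntegral rectIntegral
  rw [← e1, ← e2]
  ring

/-- Moving a horizontal ray, for an integrand that is small at infinity. -/
theorem integral_ray_sub_integral_ray {x₀ c d : ℝ} {F : ℂ → ℂ} {B : ℝ → ℝ} (hcd : c ≤ d)
    (hF : Differentiable ℂ F)
    (hc : IntegrableOn (fun x : ℝ => F (x + c * I)) (Ioi x₀))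
    (hd : IntegrableOn (fun x : ℝ => F (x + d * I)) (Ioi x₀))
    (hB : Tendsto B atTop (𝓝 0)) (hFB : ∀ x y : ℝ, y ∈ Icc c d → ‖F (x + y * I)‖ ≤ B x) :
    (∫ x : ℝ in Ioi x₀, F (x + c * I)) - (∫ x : ℝ in Ioi x₀, F (x + d * I)) =
      I * ∫ y : ℝ in c..d, F (x₀ + y * I) := by
  have l1 := intervalIntegral_tendsto_integral_Ioi x₀ hc tendsto_id
  have l2 := intervalIntegral_tendsto_integral_Ioi x₀ hd tendsto_id
  have l3 : Tendsto (fun X : ℝ => I * ∫ y : ℝ in c..d, F (X + y * I)) atTop (𝓝 0) := by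
    refine squeeze_zero_norm (a := fun X => B X * |d - c|) (fun X => ?_)
      (by simpa using hB.mul_const |d - c|)
    rw [norm_mul, norm_I, one_mul]
    refine intervalIntegral.norm_integral_le_of_norm_le_const fun y hy => hFB X y ?_
    rw [uIoc_of_le hcd] at hy
    exact ⟨hy.1.le, hy.2⟩
  have l4 : Tendsto (fun _ : ℝ => I * ∫ y : ℝ in c..d, F (x₀ + y * I)) atTop
      (𝓝 ((∫ x : ℝ in Ioi x₀, F (x + c * I)) - (∫ x : ℝ in Ioi x₀, F (x + d * I)) + 0)) := by
    refine ((l1.sub l2).add l3).congr' ?_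
    filter_upwards [eventually_ge_atTop x₀] with X hX
    -- Cauchy's theorem on `[x₀, X] × [c, d]`; the side at `X` vanishes in the limit by `l3`.
    have := rectIntegral_eq_zero (a := x₀) (b := X) hX hcd hF.differentiableOn
    unfold rectIntegral at this
    simp only [id]
    linear_combination this
  simpa using tendsto_nhds_unique l4 tendsto_const_nhds

/-- Enlarging the opening of the half strip, for an integrand that is small at infinity. -/
theorem stripIntegral_eq_of_le {x₀ φ ψ : ℝ} {F : ℂ → ℂ} {B : ℝ → ℝ} (hφψ : φ ≤ ψ)
    (hF : Differentiable ℂ F) (hφ : StripIntegrable x₀ φ F) (hψ : StripIntegrable x₀ ψ F)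
    (hB : Tendsto B atTop (𝓝 0))
    (hFB : ∀ x y : ℝ, |y| ∈ Icc φ ψ → ‖F (x + y * I)‖ ≤ B x) (h0 : 0 ≤ φ) :
    stripIntegral x₀ φ F = stripIntegral x₀ ψ F := by
  have e1 := integral_ray_sub_integral_ray hφψ hF hφ.1 hψ.1 hB fun x y hy => hFB x y (by
    rwa [abs_of_nonneg (h0.trans hy.1)])
  have e2 := integral_ray_sub_integral_ray (neg_le_neg hφψ) hF hψ.2.1 hφ.2.1 hB
    fun x y hy => hFB x y (by
      rw [abs_of_nonpos (by linarith [hy.2])]; exact ⟨by linarith [hy.2], by linarith [hy.1]⟩)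
  have hi : ∀ a b : ℝ, IntervalIntegrable (fun y : ℝ => F (x₀ + y * I)) volume a b := fun a b =>
    (hF.continuous.comp (by fun_prop)).intervalIntegrable a b
  have e3 := intervalIntegral.integral_add_adjacent_intervals (hi (-ψ) (-φ)) (hi (-φ) φ)
  have e4 := intervalIntegral.integral_add_adjacent_intervals (hi (-ψ) φ) (hi φ ψ)
  unfold stripIntegral
  rw [← e4, ← e3]
  linear_combination e1 + e2

/-- The values of the primitive at the two corners cancel, and its ends at infinity vanish. This
provides integration by parts for Hankel integrals. -/
theorem stripIntegral_deriv_eq_zero {x₀ φ : ℝ} {G G' : ℂ → ℂ}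
    (hG : ∀ w, HasDerivAt G (G' w) w) (hcont : Continuous G') (hG' : StripIntegrable x₀ φ G')
    (hp : Tendsto (fun x : ℝ => G (x + φ * I)) atTop (𝓝 0))
    (hm : Tendsto (fun x : ℝ => G (x + (-φ : ℝ) * I)) atTop (𝓝 0)) :
    stripIntegral x₀ φ G' = 0 := by
  have hor : ∀ c x : ℝ, HasDerivAt (fun x : ℝ => G (x + c * I)) (G' (x + c * I)) x := by
    intro c x
    have h1 : HasDerivAt (fun x : ℝ => (x : ℂ) + c * I) 1 x :=
      (hasDerivAt_id x).ofReal_comp.add_const _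
    have h2 := (hG _).comp x h1
    rwa [mul_one] at h2
  have ver : ∀ y : ℝ, HasDerivAt (fun y : ℝ => G (x₀ + y * I)) (I * G' (x₀ + y * I)) y := by
    intro y
    have h1 : HasDerivAt (fun y : ℝ => (x₀ : ℂ) + y * I) (1 * I) y :=
      ((hasDerivAt_id y).ofReal_comp.mul_const I).const_add _
    have h2 := (hG _).comp y h1
    rwa [one_mul, mul_comm] at h2
  have e1 := integral_Ioi_of_hasDerivAt_of_tendsto' (fun x _ => hor φ x) hG'.1 hp
  have e2 := integral_Ioi_of_hasDerivAt_of_tendsto' (fun x _ => hor (-φ) x) hG'.2.1 hm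
  have e3 := intervalIntegral.integral_eq_sub_of_hasDerivAt (a := -φ) (b := φ) (fun y _ => ver y)
    ((by fun_prop : Continuous fun y : ℝ => I * G' (x₀ + y * I)).intervalIntegrable _ _)
  rw [intervalIntegral.integral_const_mul] at e3
  unfold stripIntegral
  rw [e1, e2, e3]
  ring

end ContourTools

/-! ### Hankel's formula for `1 / Γ`. -/

section Hankel

open Complex Filter Topology

theorem tendsto_exp_neg_mul_exp_add_mul_atTop {c : ℝ} (hc : 0 < c) (b : ℝ) :
    Tendsto (fun x : ℝ => Real.exp (-c * Real.exp x + b * x)) atTop (𝓝 0) := by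
  refine ((tendsto_rpow_mul_exp_neg_mul_atTop_nhds_zero b c hc).comp
    Real.tendsto_exp_atTop).congr fun x => ?_
  simp only [Function.comp]
  rw [← Real.exp_mul, ← Real.exp_add]
  congr 1; ring

theorem integrableOn_exp_neg_mul_exp_add_mul {c : ℝ} (hc : 0 < c) (b a : ℝ) :
    IntegrableOn (fun x : ℝ => Real.exp (-c * Real.exp x + b * x)) (Ioi a) := by
  refine integrable_of_isBigO_exp_neg one_pos (by fun_prop) ?_
  refine (Asymptotics.isBigO_of_div_tendsto_nhds (.of_forall fun x hx => ?_) 0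
    ((tendsto_exp_neg_mul_exp_add_mul_atTop hc (b + 1)).congr fun x => ?_))
  · exact absurd hx (Real.exp_pos _).ne'
  · simp only [Pi.div_apply]
    rw [← Real.exp_sub]; congr 1; ring

/-- Euler's integral after the substitution `u = exp x`. -/
theorem integrable_and_integral_exp_neg_exp_add_mul {b : ℝ} (hb : 0 < b) :
    Integrable (fun x : ℝ => Real.exp (-Real.exp x + b * x)) ∧
      ∫ x : ℝ, Real.exp (-Real.exp x + b * x) = Real.Gamma b := by
  have him : Real.exp '' univ = Ioi 0 := by rw [image_univ, Real.range_exp]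
  have hd : ∀ x ∈ (univ : Set ℝ), HasDerivWithinAt Real.exp (Real.exp x) univ x :=
    fun x _ => (Real.hasDerivAt_exp x).hasDerivWithinAt
  have hfun : (fun x : ℝ => |Real.exp x| • (Real.exp (-Real.exp x) * Real.exp x ^ (b - 1))) =
      fun x : ℝ => Real.exp (-Real.exp x + b * x) := by
    ext x
    rw [abs_of_pos (Real.exp_pos x), ← Real.exp_mul, ← Real.exp_add, smul_eq_mul, ← Real.exp_add]
    congr 1; ring
  have h1 := integrableOn_image_iff_integrableOn_abs_deriv_smul MeasurableSet.univ hd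
    Real.exp_injective.injOn (fun x => Real.exp (-x) * x ^ (b - 1))
  have h2 := integral_image_eq_integral_abs_deriv_smul MeasurableSet.univ hd
    Real.exp_injective.injOn (fun x => Real.exp (-x) * x ^ (b - 1))
  rw [him, hfun] at h1 h2
  refine ⟨by simpa using h1.1 (Real.GammaIntegral_convergent hb), ?_⟩
  rw [Real.Gamma_eq_integral hb, h2, setIntegral_univ]

/-- The integrand of Hankel's formula for `1 / Γ(s)`, in the variable `w = log u`. -/
noncomputable def hankelKernel (s : ℝ) (w : ℂ) : ℂ := cexp (cexp w + ((1 - s : ℝ) : ℂ) * w)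

theorem differentiable_hankelKernel (s : ℝ) : Differentiable ℂ (hankelKernel s) := by
  unfold hankelKernel; fun_prop

theorem norm_hankelKernel (s x y : ℝ) :
    ‖hankelKernel s (x + y * I)‖ = Real.exp (Real.cos y * Real.exp x + (1 - s) * x) := by
  rw [hankelKernel, norm_exp]
  congr 1
  simp only [add_re, exp_re, ofReal_re, mul_re, I_re, ofReal_im, I_im, add_im, mul_im]
  simp [mul_comm]

theorem cos_le_cos_of_abs_mem_Icc {φ y : ℝ} (hφ : 0 ≤ φ) (hy : |y| ∈ Icc φ Real.pi) :
    Real.cos y ≤ Real.cos φ := by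
  rw [← Real.cos_abs y]
  exact Real.cos_le_cos_of_nonneg_of_le_pi hφ hy.2 hy.1

theorem norm_hankelKernel_le (s : ℝ) {φ : ℝ} (hφ : 0 ≤ φ) {x y : ℝ} (hy : |y| ∈ Icc φ Real.pi) :
    ‖hankelKernel s (x + y * I)‖ ≤ Real.exp (-(-Real.cos φ) * Real.exp x + (1 - s) * x) := by
  rw [norm_hankelKernel, neg_neg]
  gcongr
  exact cos_le_cos_of_abs_mem_Icc hφ hy

theorem neg_cos_pos {φ : ℝ} (hφ : Real.pi / 2 < φ) (hφπ : φ ≤ Real.pi) : 0 < -Real.cos φ :=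
  neg_pos.2 (Real.cos_neg_of_pi_div_two_lt_of_lt hφ (by linarith [Real.pi_pos]))

theorem tendsto_hankelKernel_ray (s : ℝ) {φ y : ℝ} (hφ : Real.pi / 2 < φ)
    (hy : |y| ∈ Icc φ Real.pi) :
    Tendsto (fun x : ℝ => hankelKernel s (x + y * I)) atTop (𝓝 0) :=
  squeeze_zero_norm (fun _ => norm_hankelKernel_le s (by linarith [Real.pi_pos]) hy)
    (tendsto_exp_neg_mul_exp_add_mul_atTop (neg_cos_pos hφ (hy.1.trans hy.2)) _)

theorem integrableOn_hankelKernel_ray (s : ℝ) {φ y : ℝ} (x₀ : ℝ) (hφ : Real.pi / 2 < φ)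
    (hy : |y| ∈ Icc φ Real.pi) :
    IntegrableOn (fun x : ℝ => hankelKernel s (x + y * I)) (Ioi x₀) := by
  refine (integrableOn_exp_neg_mul_exp_add_mul (neg_cos_pos hφ (hy.1.trans hy.2)) (1 - s) x₀).mono'
    ?_ (.of_forall fun _ => norm_hankelKernel_le s (by linarith [Real.pi_pos]) hy)
  have := (differentiable_hankelKernel s).continuous
  exact Continuous.aestronglyMeasurable (by fun_prop)

theorem stripIntegrable_hankelKernel (s x₀ : ℝ) {φ : ℝ} (hφ : Real.pi / 2 < φ)
    (hφπ : φ ≤ Real.pi) : StripIntegrable x₀ φ (hankelKernel s) := by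
  have h0 : 0 ≤ φ := by linarith [Real.pi_pos]
  have := (differentiable_hankelKernel s).continuous
  refine ⟨integrableOn_hankelKernel_ray s x₀ hφ ?_, integrableOn_hankelKernel_ray s x₀ hφ ?_,
    Continuous.intervalIntegrable (by fun_prop) _ _⟩
  · rw [abs_of_nonneg h0]; exact ⟨le_rfl, hφπ⟩
  · rw [abs_neg, abs_of_nonneg h0]; exact ⟨le_rfl, hφπ⟩

theorem hankelKernel_add_pi (s x : ℝ) :
    hankelKernel s (x + Real.pi * I) =
      ((Real.exp (-Real.exp x + (1 - s) * x) : ℝ) : ℂ) * cexp ((((1 - s) * Real.pi : ℝ) : ℂ) * I) := by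
  have : cexp (x + Real.pi * I) = -cexp x := by rw [exp_add, exp_pi_mul_I]; ring
  rw [hankelKernel, this, ofReal_exp, ← Complex.exp_add]
  congr 1; push_cast; ring

theorem hankelKernel_sub_pi (s x : ℝ) :
    hankelKernel s (x + (-Real.pi : ℝ) * I) =
      ((Real.exp (-Real.exp x + (1 - s) * x) : ℝ) : ℂ) *
        cexp (-(((1 - s) * Real.pi : ℝ) : ℂ) * I) := by
  have : cexp (x + (-Real.pi : ℝ) * I) = -cexp x := by
    rw [exp_add, ofReal_neg, neg_mul, exp_neg, exp_pi_mul_I]; ring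
  rw [hankelKernel, this, ofReal_exp, ← Complex.exp_add]
  congr 1; push_cast; ring

/-- On `im w = ±π` one has `exp w = -exp x`, so the two rays carry the same real integrand with the
phases `exp (±i(1-s)π)`, whose difference is `2i sin (πs)`. -/
theorem stripIntegral_pi_hankelKernel_eq (s x₀ : ℝ) :
    stripIntegral x₀ Real.pi (hankelKernel s) =
      (∫ x in Ioi x₀, Real.exp (-Real.exp x + (1 - s) * x) : ℝ) * (2 * I * Real.sin (Real.pi * s)) +
        I * ∫ y : ℝ in (-Real.pi)..Real.pi, hankelKernel s (x₀ + y * I) := by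
  have hsin : Real.sin (Real.pi * s) = Real.sin ((1 - s) * Real.pi) := by
    rw [← Real.sin_pi_sub]; congr 1; ring
  rw [stripIntegral]
  simp_rw [hankelKernel_add_pi, hankelKernel_sub_pi]
  rw [integral_mul_const, integral_mul_const, integral_complex_ofReal, hsin, ofReal_sin,
    Complex.sin]
  linear_combination (-(∫ x in Ioi x₀, Real.exp (-Real.exp x + (1 - s) * x) : ℝ) *
    (cexp (-(((1 - s) * Real.pi : ℝ) : ℂ) * I) - cexp ((((1 - s) * Real.pi : ℝ) : ℂ) * I))) * I_mul_I

theorem stripIntegral_hankelKernel_eq_of_le (s : ℝ) {x₀ x₁ φ : ℝ} (h : x₀ ≤ x₁)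
    (hφ : Real.pi / 2 < φ) (hφπ : φ ≤ Real.pi) :
    stripIntegral x₀ φ (hankelKernel s) = stripIntegral x₁ φ (hankelKernel s) := by
  have hi := stripIntegrable_hankelKernel s x₀ hφ hφπ
  rw [stripIntegral_eq_sub_rectIntegral h hi.1 hi.2.1, rectIntegral_eq_zero h
    (by linarith [Real.pi_pos]) (differentiable_hankelKernel s).differentiableOn, sub_zero]

theorem tendsto_integral_segment_hankelKernel {s : ℝ} (hs : s < 1) :
    Tendsto (fun x₀ : ℝ => ∫ y : ℝ in (-Real.pi)..Real.pi, hankelKernel s (x₀ + y * I))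
      atBot (𝓝 0) := by
  have hlim : Tendsto (fun x₀ : ℝ => Real.exp (1 + (1 - s) * x₀) * |Real.pi - -Real.pi|)
      atBot (𝓝 0) := by
    have h1 : Tendsto (fun x₀ : ℝ => 1 + (1 - s) * x₀) atBot atBot :=
      tendsto_atBot_add_const_left _ _ (tendsto_id.const_mul_atBot (sub_pos.2 hs))
    simpa using (Real.tendsto_exp_atBot.comp h1).mul_const |Real.pi - -Real.pi|
  refine squeeze_zero_norm' ?_ hlim
  filter_upwards [eventually_le_atBot 0] with x₀ hx₀
  refine intervalIntegral.norm_integral_le_of_norm_le_const fun y _ => ?_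
  rw [norm_hankelKernel]
  gcongr
  have h2 : Real.exp x₀ ≤ 1 := Real.exp_le_one_iff.2 hx₀
  nlinarith [Real.cos_le_one y, Real.exp_pos x₀]

/-- At `s = 1` the damping factor `exp ((1-s)w)` is absent: the integrand tends to `1` and the
segment survives. -/
theorem tendsto_integral_segment_hankelKernel_one :
    Tendsto (fun x₀ : ℝ => ∫ y : ℝ in (-Real.pi)..Real.pi, hankelKernel 1 (x₀ + y * I))
      atBot (𝓝 (2 * Real.pi)) := by
  have hc : Continuous fun a : ℝ => ∫ y : ℝ in (-Real.pi)..Real.pi, cexp (a * cexp (y * I)) :=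
    intervalIntegral.continuous_parametric_intervalIntegral_of_continuous'
      (by simp only [Function.uncurry_def]; fun_prop) _ _
  have h := (hc.tendsto 0).comp Real.tendsto_exp_atBot
  have h0 : (∫ y : ℝ in (-Real.pi)..Real.pi, cexp ((0 : ℝ) * cexp (y * I))) = 2 * Real.pi := by
    simp; ring
  rw [h0] at h
  refine h.congr fun x₀ => ?_
  simp only [Function.comp]
  refine intervalIntegral.integral_congr fun y _ => ?_
  simp [hankelKernel, exp_add]

/-- The left side does not depend on `x₀`, so let `x₀ → -∞`. For `s < 1` the segment disappears, and
the rays give `2i sin (πs) Γ(1-s)`, evaluated by the reflection formula. For `s = 1` the rays cancel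
and the segment gives `2πi`. -/
theorem stripIntegral_pi_hankelKernel {s : ℝ} (x₀ : ℝ) (hs0 : 0 < s) (hs1 : s ≤ 1) :
    stripIntegral x₀ Real.pi (hankelKernel s) = 2 * Real.pi * I / Gamma s := by
  have hpi : Real.pi / 2 < Real.pi := by linarith [Real.pi_pos]
  suffices h : Tendsto (fun x => stripIntegral x Real.pi (hankelKernel s)) atBot
      (𝓝 (2 * Real.pi * I / Gamma s)) by
    refine tendsto_nhds_unique (tendsto_const_nhds.congr' ?_) h
    filter_upwards [eventually_le_atBot x₀] with x hx
    exact (stripIntegral_hankelKernel_eq_of_le s hx hpi le_rfl).symm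
  simp_rw [stripIntegral_pi_hankelKernel_eq]
  rcases hs1.lt_or_eq with hs1 | rfl
  · obtain ⟨hint, hval⟩ := integrable_and_integral_exp_neg_exp_add_mul (sub_pos.2 hs1)
    have h1 := (aecover_Ioi (μ := volume) (tendsto_id (α := ℝ) (x := atBot))).integral_tendsto_of_countably_generated
      hint
    rw [hval] at h1
    have h2 := (((continuous_ofReal.tendsto _).comp h1).mul_const
      (2 * I * Real.sin (Real.pi * s) : ℂ)).add
      ((tendsto_integral_segment_hankelKernel hs1).const_mul I)
    refine h2.trans (le_of_eq (congrArg 𝓝 ?_))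
    have hg : Real.Gamma s ≠ 0 := (Real.Gamma_pos_of_pos hs0).ne'
    have hsin : Real.sin (Real.pi * s) ≠ 0 :=
      (Real.sin_pos_of_pos_of_lt_pi (mul_pos Real.pi_pos hs0) (by nlinarith [Real.pi_pos])).ne'
    have hr := Real.Gamma_mul_Gamma_one_sub s
    rw [eq_div_iff hsin] at hr
    have hrc : (Real.Gamma s : ℂ) * Real.Gamma (1 - s) * Real.sin (Real.pi * s) = Real.pi := by
      exact_mod_cast hr
    rw [Gamma_ofReal, eq_div_iff (by exact_mod_cast hg)]
    linear_combination (2 * I) * hrc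
  · simpa [mul_comm, mul_assoc, mul_left_comm] using
      tendsto_integral_segment_hankelKernel_one.const_mul I

/-- The derivative of `hankelKernel (s + 1)` is `hankelKernel s - s * hankelKernel (s + 1)`, and its
integral vanishes. This is the contour form of `Γ(s+1) = s Γ(s)`, valid for every real `s`. -/
theorem stripIntegral_hankelKernel_eq_mul {s x₀ φ : ℝ} (hφ : Real.pi / 2 < φ)
    (hφπ : φ ≤ Real.pi) :
    stripIntegral x₀ φ (hankelKernel s) = s * stripIntegral x₀ φ (hankelKernel (s + 1)) := by
  have h0 : 0 ≤ φ := by linarith [Real.pi_pos]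
  have hd : ∀ w, HasDerivAt (hankelKernel (s + 1))
      (hankelKernel s w + (-s : ℂ) * hankelKernel (s + 1) w) w := by
    intro w
    have h1 : HasDerivAt (fun w => cexp w + ((1 - (s + 1) : ℝ) : ℂ) * w)
        (cexp w + ((1 - (s + 1) : ℝ) : ℂ) * 1) w :=
      (hasDerivAt_exp w).add ((hasDerivAt_id w).const_mul _)
    refine h1.cexp.congr_deriv ?_
    have : hankelKernel s w = hankelKernel (s + 1) w * cexp w := by
      rw [hankelKernel, hankelKernel, ← Complex.exp_add]; congr 1; push_cast; ring
    rw [this, hankelKernel]; push_cast; ring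
  have i1 := stripIntegrable_hankelKernel s x₀ hφ hφπ
  have i2 := (stripIntegrable_hankelKernel (s + 1) x₀ hφ hφπ).const_mul (-s : ℂ)
  have c1 := (differentiable_hankelKernel s).continuous
  have c2 := (differentiable_hankelKernel (s + 1)).continuous
  have hz := stripIntegral_deriv_eq_zero (x₀ := x₀) (φ := φ) hd (by fun_prop)
    ⟨i1.1.add i2.1, i1.2.1.add i2.2.1, i1.2.2.add i2.2.2⟩
    (tendsto_hankelKernel_ray _ hφ (by rw [abs_of_nonneg h0]; exact ⟨le_rfl, hφπ⟩))
    (tendsto_hankelKernel_ray _ hφ (by rw [abs_neg, abs_of_nonneg h0]; exact ⟨le_rfl, hφπ⟩))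
  rw [stripIntegral_add i1 i2, stripIntegral_const_mul] at hz
  linear_combination hz

/-- Hankel's formula for the reciprocal of the Gamma function. -/
theorem stripIntegral_hankelKernel {s x₀ φ : ℝ} (hs : 0 < s) (hφ : Real.pi / 2 < φ)
    (hφπ : φ ≤ Real.pi) :
    stripIntegral x₀ φ (hankelKernel s) = 2 * Real.pi * I / Gamma s := by
  -- The base case `0 < s ≤ 1` opens the strip to the angle `π`; the recursion then raises `s` by
  -- one at a time.
  have key : ∀ n : ℕ, ∀ s : ℝ, 0 < s → s ≤ n + 1 →
      stripIntegral x₀ φ (hankelKernel s) = 2 * Real.pi * I / Gamma s := by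
    intro n
    induction n with
    | zero =>
      intro s hs hs1
      have h0 : 0 ≤ φ := by linarith [Real.pi_pos]
      rw [stripIntegral_eq_of_le hφπ (differentiable_hankelKernel s)
        (stripIntegrable_hankelKernel s x₀ hφ hφπ)
        (stripIntegrable_hankelKernel s x₀ (by linarith [Real.pi_pos]) le_rfl)
        (tendsto_exp_neg_mul_exp_add_mul_atTop (neg_cos_pos hφ hφπ) _)
        (fun x y hy => norm_hankelKernel_le s h0 hy) h0]
      exact stripIntegral_pi_hankelKernel x₀ hs (by simpa using hs1)
    | succ n ih =>
      intro s hs hs1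
      rcases le_or_gt s 1 with h1 | h1
      · exact ih s hs (h1.trans (by simp))
      · have hne : ((s - 1 : ℝ) : ℂ) ≠ 0 := by exact_mod_cast (sub_pos.2 h1).ne'
        have hg : Gamma s = ((s - 1 : ℝ) : ℂ) * Gamma ((s - 1 : ℝ) : ℂ) := by
          rw [← Gamma_add_one _ hne]; congr 1; push_cast; ring
        have h2 := stripIntegral_hankelKernel_eq_mul (s := s - 1) (x₀ := x₀) hφ hφπ
        rw [ih (s - 1) (sub_pos.2 h1) (by push_cast at hs1; linarith), sub_add_cancel] at h2
        rw [hg, eq_div_iff (mul_ne_zero hne (Gamma_ne_zero_of_re_pos (by simpa using h1)))]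
        rw [div_eq_iff (Gamma_ne_zero_of_re_pos (by simpa using h1))] at h2
        linear_combination -h2
  exact key ⌈s⌉₊ s hs ((Nat.le_ceil s).trans (by simp))

theorem stripIntegral_hankelKernel_zero {x₀ φ : ℝ} (hφ : Real.pi / 2 < φ) (hφπ : φ ≤ Real.pi) :
    stripIntegral x₀ φ (hankelKernel 0) = 0 := by
  rw [stripIntegral_hankelKernel_eq_mul hφ hφπ]; simp

end Hankel

/-! ### Integral representations of `E_{α,β}`. -/

section MittagLeffler

open Complex Filter Topology

theorem hasSum_integral_of_norm_le_pow_mul {X : Type*} [MeasurableSpace X] {μ : Measure X}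
    {f : ℕ → X → ℂ} {F : X → ℂ} {H : X → ℂ} {q : ℝ} (hq0 : 0 ≤ q) (hq : q < 1)
    (hH : Integrable H μ) (hf : ∀ k, AEStronglyMeasurable (f k) μ)
    (hb : ∀ k, ∀ᵐ a ∂μ, ‖f k a‖ ≤ q ^ k * ‖H a‖)
    (hs : ∀ᵐ a ∂μ, HasSum (fun k => f k a) (F a)) :
    HasSum (fun k => ∫ a, f k a ∂μ) (∫ a, F a ∂μ) := by
  refine hasSum_integral_of_dominated_convergence (fun k a => q ^ k * ‖H a‖) hf hb
    (.of_forall fun a => (summable_geometric_of_lt_one hq0 hq).mul_right _) ?_ hs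
  simp_rw [tsum_mul_right]
  exact hH.norm.const_mul _

theorem hasSum_stripIntegral {x₀ φ q : ℝ} {f : ℕ → ℂ → ℂ} {F H : ℂ → ℂ} (hφ : 0 ≤ φ)
    (hq0 : 0 ≤ q) (hq : q < 1) (hH : StripIntegrable x₀ φ H) (hf : ∀ k, Continuous (f k))
    (hb : ∀ k, ∀ w ∈ stripBoundary x₀ φ, ‖f k w‖ ≤ q ^ k * ‖H w‖)
    (hs : ∀ w ∈ stripBoundary x₀ φ, HasSum (fun k => f k w) (F w)) :
    HasSum (fun k => stripIntegral x₀ φ (f k)) (stripIntegral x₀ φ F) := by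
  have hm : ∀ (k : ℕ) (p : ℝ → ℂ) (s : Set ℝ), Continuous p →
      AEStronglyMeasurable (fun x => f k (p x)) (volume.restrict s) := fun k p s hp =>
    ((hf k).comp hp).aestronglyMeasurable
  have hle : -φ ≤ φ := by linarith
  have h1 := hasSum_integral_of_norm_le_pow_mul hq0 hq hH.1
    (fun k => hm k (fun x : ℝ => x + φ * I) _ (by fun_prop))
    (fun k => (ae_restrict_mem measurableSet_Ioi).mono fun x hx =>
      hb k _ (ray_mem_stripBoundary hφ (le_of_lt hx)))
    ((ae_restrict_mem measurableSet_Ioi).mono fun x hx =>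
      hs _ (ray_mem_stripBoundary hφ (le_of_lt hx)))
  have h2 := hasSum_integral_of_norm_le_pow_mul hq0 hq hH.2.1
    (fun k => hm k (fun x : ℝ => x + (-φ : ℝ) * I) _ (by fun_prop))
    (fun k => (ae_restrict_mem measurableSet_Ioi).mono fun x hx =>
      hb k _ (ray_neg_mem_stripBoundary hφ (le_of_lt hx)))
    ((ae_restrict_mem measurableSet_Ioi).mono fun x hx =>
      hs _ (ray_neg_mem_stripBoundary hφ (le_of_lt hx)))
  have h3 := hasSum_integral_of_norm_le_pow_mul hq0 hq
    ((intervalIntegrable_iff_integrableOn_Ioc_of_le hle).1 hH.2.2)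
    (fun k => hm k (fun y : ℝ => x₀ + y * I) _ (by fun_prop))
    (fun k => (ae_restrict_mem measurableSet_Ioc).mono fun y hy =>
      hb k _ (segment_mem_stripBoundary (Ioc_subset_Icc_self hy)))
    ((ae_restrict_mem measurableSet_Ioc).mono fun y hy =>
      hs _ (segment_mem_stripBoundary (Ioc_subset_Icc_self hy)))
  unfold stripIntegral
  simp_rw [intervalIntegral.integral_of_le hle]
  exact (h1.sub h2).add (h3.mul_left I)

/-- The integrand of the contour integral that represents `E_{α,β}(z)`, in the variable
`w = (log ζ) / α`. -/
noncomputable def mittagLefflerKernel (α β : ℝ) (z w : ℂ) : ℂ :=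
  hankelKernel β w * cexp (α * w) / (cexp (α * w) - z)

theorem hankelKernel_mul_exp (s b : ℝ) (w : ℂ) :
    hankelKernel s w * cexp (b * w) = hankelKernel (s - b) w := by
  rw [hankelKernel, hankelKernel, ← Complex.exp_add]
  congr 1; push_cast; ring

theorem norm_exp_ofReal_mul (α : ℝ) (w : ℂ) : ‖cexp (α * w)‖ = Real.exp (α * w.re) := by
  simp [norm_exp]

/-- On the boundary `re w ≥ x₀`, so `z exp (-αw)` has norm at most `q < 1`. The kernel is then a
geometric series whose `k`-th term is `z ^ k * hankelKernel (α k + β) w`, to which Hankel's formula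
applies. -/
theorem stripIntegral_mittagLefflerKernel_of_norm_lt {α β x₀ φ : ℝ} {z : ℂ} (hα : 0 < α)
    (hβ : 0 < β) (hφ : Real.pi / 2 < φ) (hφπ : φ ≤ Real.pi) (hz : ‖z‖ < Real.exp (α * x₀)) :
    stripIntegral x₀ φ (mittagLefflerKernel α β z) =
      2 * Real.pi * I * mittagLeffler α β z := by
  have h0 : 0 ≤ φ := by linarith [Real.pi_pos]
  set q : ℝ := ‖z‖ * Real.exp (-(α * x₀)) with hqdef
  have hq0 : 0 ≤ q := by positivity
  have hq : q < 1 := by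
    rw [hqdef, Real.exp_neg, ← div_eq_mul_inv, div_lt_one (Real.exp_pos _)]; exact hz
  have hterm : ∀ (k : ℕ) (w : ℂ), z ^ k * hankelKernel (α * k + β) w =
      hankelKernel β w * (z * cexp (-(α * w))) ^ k := by
    intro k w
    have := hankelKernel_mul_exp β (-(α * k)) w
    rw [sub_neg_eq_add, add_comm β] at this
    rw [← this, mul_pow, ← Complex.exp_nat_mul]
    have : ((-(α * k) : ℝ) : ℂ) * w = k * -(α * w) := by push_cast; ring
    rw [this]; ring
  have hr : ∀ w ∈ stripBoundary x₀ φ, ‖z * cexp (-(α * w))‖ ≤ q := by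
    intro w hw
    rw [norm_mul, norm_exp, hqdef]
    gcongr
    simpa using mul_le_mul_of_nonneg_left hw.1 hα.le
  have hsum := hasSum_stripIntegral (x₀ := x₀) (F := mittagLefflerKernel α β z) h0 hq0 hq
    (stripIntegrable_hankelKernel β x₀ hφ hφπ)
    (f := fun k w => z ^ k * hankelKernel (α * k + β) w)
    (fun k => by have := (differentiable_hankelKernel (α * k + β)).continuous; fun_prop)
    (fun k w hw => by
      rw [hterm, norm_mul, norm_pow, mul_comm]
      gcongr
      exact hr w hw)
    (fun w hw => by
      simp_rw [hterm]
      have hg := (hasSum_geometric_of_norm_lt_one ((hr w hw).trans_lt hq)).mul_left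
        (hankelKernel β w)
      have hne : cexp (α * w) ≠ 0 := Complex.exp_ne_zero _
      have hF : mittagLefflerKernel α β z w = hankelKernel β w * (1 - z * cexp (-(α * w)))⁻¹ := by
        rw [mittagLefflerKernel, mul_div_assoc, exp_neg, ← one_div, ← div_eq_mul_inv,
          one_sub_div hne, one_div_div]
      rwa [hF])
  rw [mittagLeffler, ← tsum_mul_left, ← hsum.tsum_eq]
  congr 1; ext k
  rw [stripIntegral_const_mul, stripIntegral_hankelKernel (by positivity) hφ hφπ]
  push_cast; ring

theorem StripIntegrable.mono {x₀ φ : ℝ} {F G : ℂ → ℂ} (hφ : 0 ≤ φ) (hG : StripIntegrable x₀ φ G)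
    (hF : ContinuousOn F (stripBoundary x₀ φ))
    (h : ∀ w ∈ stripBoundary x₀ φ, ‖F w‖ ≤ ‖G w‖) : StripIntegrable x₀ φ F := by
  have hle : -φ ≤ φ := by linarith
  refine ⟨Integrable.mono hG.1 (ContinuousOn.aestronglyMeasurable (hF.comp (by fun_prop)
      fun x hx => ray_mem_stripBoundary hφ (le_of_lt hx)) measurableSet_Ioi)
      ((ae_restrict_mem measurableSet_Ioi).mono fun x hx =>
        h _ (ray_mem_stripBoundary hφ (le_of_lt hx))),
    Integrable.mono hG.2.1 (ContinuousOn.aestronglyMeasurable (hF.comp (by fun_prop)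
      fun x hx => ray_neg_mem_stripBoundary hφ (le_of_lt hx)) measurableSet_Ioi)
      ((ae_restrict_mem measurableSet_Ioi).mono fun x hx =>
        h _ (ray_neg_mem_stripBoundary hφ (le_of_lt hx))),
    ContinuousOn.intervalIntegrable (hF.comp (by fun_prop) fun y hy => ?_)⟩
  rw [uIcc_of_le hle] at hy
  exact segment_mem_stripBoundary hy

/-- The arc length integral of `‖F‖` over the boundary of a half strip. -/
noncomputable def stripNormIntegral (x₀ φ : ℝ) (F : ℂ → ℂ) : ℝ :=
  (∫ x : ℝ in Ioi x₀, ‖F (x + φ * I)‖) + (∫ x : ℝ in Ioi x₀, ‖F (x + (-φ : ℝ) * I)‖) +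
    ∫ y : ℝ in (-φ)..φ, ‖F (x₀ + y * I)‖

theorem stripNormIntegral_nonneg {x₀ φ : ℝ} (hφ : 0 ≤ φ) (F : ℂ → ℂ) :
    0 ≤ stripNormIntegral x₀ φ F :=
  add_nonneg (add_nonneg (integral_nonneg fun _ => norm_nonneg _)
    (integral_nonneg fun _ => norm_nonneg _))
    (intervalIntegral.integral_nonneg (by linarith) fun _ _ => norm_nonneg _)

theorem norm_stripIntegral_le {x₀ φ C : ℝ} {F G : ℂ → ℂ} (hφ : 0 ≤ φ)
    (hG : StripIntegrable x₀ φ G) (h : ∀ w ∈ stripBoundary x₀ φ, ‖F w‖ ≤ C * ‖G w‖) :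
    ‖stripIntegral x₀ φ F‖ ≤ C * stripNormIntegral x₀ φ G := by
  have hle : -φ ≤ φ := by linarith
  have h1 := norm_integral_le_of_norm_le (hG.1.norm.const_mul C)
    ((ae_restrict_mem measurableSet_Ioi).mono fun x hx =>
      h _ (ray_mem_stripBoundary hφ (le_of_lt hx)))
  have h2 := norm_integral_le_of_norm_le (hG.2.1.norm.const_mul C)
    ((ae_restrict_mem measurableSet_Ioi).mono fun x hx =>
      h _ (ray_neg_mem_stripBoundary hφ (le_of_lt hx)))
  have h3 := intervalIntegral.norm_integral_le_of_norm_le hle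
    (.of_forall fun y hy => h _ (segment_mem_stripBoundary (Ioc_subset_Icc_self hy)))
    (hG.2.2.norm.const_mul C)
  rw [integral_const_mul] at h1 h2
  rw [intervalIntegral.integral_const_mul] at h3
  have h4 : ‖I * ∫ y : ℝ in (-φ)..φ, F (x₀ + y * I)‖ = ‖∫ y : ℝ in (-φ)..φ, F (x₀ + y * I)‖ := by
    rw [norm_mul, norm_I, one_mul]
  unfold stripIntegral stripNormIntegral
  refine (norm_add_le _ _).trans ((add_le_add_left (norm_sub_le _ _) _).trans ?_)
  rw [h4]
  linarith

theorem stripIntegrable_mittagLefflerKernel {α β x₀ φ δ : ℝ} {z : ℂ}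
    (hφ : Real.pi / 2 < φ) (hφπ : φ ≤ Real.pi) (hδ : 0 < δ)
    (h : ∀ w ∈ stripBoundary x₀ φ, δ ≤ ‖cexp (α * w) - z‖) :
    StripIntegrable x₀ φ (mittagLefflerKernel α β z) := by
  have h0 : 0 ≤ φ := by linarith [Real.pi_pos]
  refine ((stripIntegrable_hankelKernel (β - α) x₀ hφ hφπ).const_mul (δ⁻¹ : ℝ)).mono h0 ?_ ?_
  · have := (differentiable_hankelKernel β).continuous
    refine ContinuousOn.div (by fun_prop) (by fun_prop) fun w hw => ?_
    exact norm_pos_iff.1 (hδ.trans_le (h w hw))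
  · intro w hw
    rw [mittagLefflerKernel, hankelKernel_mul_exp, norm_div, norm_mul, norm_real, Real.norm_eq_abs,
      abs_of_pos (inv_pos.2 hδ), div_eq_inv_mul]
    gcongr
    exact h w hw

/-- The integral representation of `E_{α,β}(z)` for `z` to the left of the contour. -/
theorem stripIntegral_mittagLefflerKernel_of_lt_abs_arg {α β x₀ φ δ : ℝ} {z : ℂ} (hα : 0 < α)
    (hβ : 0 < β) (hφ : Real.pi / 2 < φ) (hφπ : φ ≤ Real.pi) (hδ : 0 < δ)
    (h : ∀ w ∈ stripBoundary x₀ φ, δ ≤ ‖cexp (α * w) - z‖)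
    (hαφ : α * φ < Real.pi) (harg : α * φ < |arg z|) :
    stripIntegral x₀ φ (mittagLefflerKernel α β z) = 2 * Real.pi * I * mittagLeffler α β z := by
  obtain ⟨x₁, hx₁, hz⟩ : ∃ x₁, x₀ ≤ x₁ ∧ ‖z‖ < Real.exp (α * x₁) := by
    have : Tendsto (fun x : ℝ => Real.exp (α * x)) atTop atTop :=
      Real.tendsto_exp_atTop.comp (tendsto_id.const_mul_atTop hα)
    obtain ⟨x, h1, h2⟩ := ((eventually_ge_atTop x₀).and (this.eventually_gt_atTop ‖z‖)).exists
    exact ⟨x, h1, h2⟩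
  have hi := stripIntegrable_mittagLefflerKernel (β := β) hφ hφπ hδ h
  have h0 : 0 ≤ φ := by linarith [Real.pi_pos]
  rw [stripIntegral_eq_sub_rectIntegral hx₁ hi.1 hi.2.1,
    stripIntegral_mittagLefflerKernel_of_norm_lt hα hβ hφ hφπ hz, rectIntegral_eq_zero hx₁
      (by linarith), sub_zero]
  have := differentiable_hankelKernel β
  refine DifferentiableOn.div (by fun_prop) (by fun_prop) fun w hw => sub_ne_zero.2 fun he => ?_
  -- A zero of the denominator in the strip would force `arg z = α * w.im`, since `α φ < π` makes
  -- `log` invert `exp` there.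
  have him : |α * w.im| ≤ α * φ := by
    rw [abs_mul, abs_of_pos hα]; exact mul_le_mul_of_nonneg_left (abs_le.2 hw.2) hα.le
  have := abs_le.1 him
  have ha : arg z = α * w.im := by
    rw [← he, ← log_im, log_exp] <;> simp <;> linarith
  rw [ha] at harg
  linarith

/-- The integral representation of `E_{α,β}(z)` for `z` to the right of the contour. -/
theorem stripIntegral_mittagLefflerKernel_of_abs_arg_lt {α β x₀ φ δ : ℝ} {z : ℂ} (hα : 0 < α)
    (hβ : 0 < β) (hφ : Real.pi / 2 < φ) (hφπ : φ ≤ Real.pi) (hδ : 0 < δ)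
    (h : ∀ w ∈ stripBoundary x₀ φ, δ ≤ ‖cexp (α * w) - z‖)
    (hαφ : α * φ < Real.pi) (harg : |arg z| < α * φ) (hz : Real.exp (α * x₀) < ‖z‖) :
    stripIntegral x₀ φ (mittagLefflerKernel α β z) =
      2 * Real.pi * I * (mittagLeffler α β z - 1 / α * hankelKernel β (log z / α)) := by
  have hz0 : z ≠ 0 := norm_pos_iff.1 ((Real.exp_pos _).trans hz)
  have hαc : (α : ℂ) ≠ 0 := by exact_mod_cast hα.ne'
  set w₀ : ℂ := log z / α with hw₀
  have hαw₀ : α * w₀ = log z := by rw [hw₀]; field_simp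
  have hexp : cexp (α * w₀) = z := by rw [hαw₀, exp_log hz0]
  have hre : α * w₀.re = Real.log ‖z‖ := by
    have := congrArg re hαw₀
    rwa [re_ofReal_mul, log_re] at this
  have him : α * w₀.im = arg z := by
    have := congrArg im hαw₀
    rwa [im_ofReal_mul, log_im] at this
  have hw₀re : x₀ < w₀.re := by
    rw [← mul_lt_mul_iff_right₀ hα, hre]
    exact (Real.lt_log_iff_exp_lt (norm_pos_iff.2 hz0)).2 hz
  have hw₀im : |w₀.im| < φ := by
    rw [← mul_lt_mul_iff_right₀ hα]
    calc α * |w₀.im| = |arg z| := by rw [← him, abs_mul, abs_of_pos hα]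
      _ < α * φ := harg
  obtain ⟨x₁, hx₁, hzx⟩ : ∃ x₁, w₀.re < x₁ ∧ ‖z‖ < Real.exp (α * x₁) := by
    have : Tendsto (fun x : ℝ => Real.exp (α * x)) atTop atTop :=
      Real.tendsto_exp_atTop.comp (tendsto_id.const_mul_atTop hα)
    obtain ⟨x, h1, h2⟩ := ((eventually_gt_atTop w₀.re).and (this.eventually_gt_atTop ‖z‖)).exists
    exact ⟨x, h1, h2⟩
  have hi := stripIntegrable_mittagLefflerKernel (β := β) hφ hφπ hδ h
  set D : ℂ → ℂ := fun w => cexp (α * w) - z with hD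
  have hDdiff : Differentiable ℂ D := by fun_prop
  have hD₀ : D w₀ = 0 := by simp [hD, hexp]
  have hderiv : deriv D w₀ = α * z := by
    have h1 : HasDerivAt D (cexp (α * w₀) * (α * 1)) w₀ :=
      (((hasDerivAt_id w₀).const_mul (α : ℂ)).cexp).sub_const z
    rw [h1.deriv, hexp]; ring
  -- Splits off the zero `w₀` of the denominator: `D w = (w - w₀) * k w`, with `k w₀ = α z`.
  set k : ℂ → ℂ := dslope D w₀ with hk
  have hkdiff : Differentiable ℂ k := by
    rw [← differentiableOn_univ, hk, differentiableOn_dslope univ_mem]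
    exact hDdiff.differentiableOn
  have hkD : ∀ w, D w = (w - w₀) * k w := by
    intro w
    have := sub_smul_dslope D w₀ w
    rw [hD₀, sub_zero, smul_eq_mul] at this
    exact this.symm
  have hkw₀ : k w₀ = α * z := by rw [hk, dslope_same, hderiv]
  -- `w₀` is the only zero of `D` in the closed strip, as `exp (α ·)` is injective there, and it is
  -- simple.
  have hkne : ∀ w : ℂ, |w.im| ≤ φ → k w ≠ 0 := by
    intro w hw hkw
    rcases eq_or_ne w w₀ with rfl | hne
    · rw [hkw₀] at hkw; exact mul_ne_zero hαc hz0 hkw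
    · have h1 : D w = 0 := by rw [hkD, hkw, mul_zero]
      have h2 : cexp (α * w) = cexp (α * w₀) := by rw [hexp]; exact sub_eq_zero.1 h1
      have himw : |α * w.im| ≤ α * φ := by
        rw [abs_mul, abs_of_pos hα]; exact mul_le_mul_of_nonneg_left hw hα.le
      have b1 := abs_le.1 himw
      have b2 := abs_lt.1 harg
      have h3 : (α * w : ℂ) = α * w₀ := by
        refine Complex.exp_inj_of_neg_pi_lt_of_le_pi ?_ ?_ ?_ ?_ h2 <;>
          simp only [im_ofReal_mul, him] <;> linarith
      exact hne (mul_left_cancel₀ hαc h3)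
  have hfun : mittagLefflerKernel α β z =
      fun w => (hankelKernel β w * cexp (α * w) / k w) / (w - w₀) := by
    ext w
    rw [mittagLefflerKernel, div_div, mul_comm (k w), ← hkD]
  have hrect : rectIntegral x₀ x₁ (-φ) φ (mittagLefflerKernel α β z) =
      2 * Real.pi * I * (1 / α * hankelKernel β w₀) := by
    have hdh := differentiable_hankelKernel β
    rw [hfun, rectIntegral_div_sub hw₀re hx₁ (abs_lt.1 hw₀im).1 (abs_lt.1 hw₀im).2]
    · rw [hexp, hkw₀]; field_simp
    · exact DifferentiableOn.div (by fun_prop) hkdiff.differentiableOn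
        fun w hw => hkne w (abs_le.2 hw.2)
  rw [stripIntegral_eq_sub_rectIntegral (hw₀re.trans hx₁).le hi.1 hi.2.1, hrect,
    stripIntegral_mittagLefflerKernel_of_norm_lt hα hβ hφ hφπ hzx]
  ring

end MittagLeffler

/-! ### Arc length integrals and the lower bound for `|ζ - z|`. -/

section ArcLength

open Complex Filter Topology

theorem polarPoint_exp (α x y : ℝ) :
    polarPoint (Real.exp (α * x)) (α * y) = cexp (α * (x + y * I)) := by
  rw [polarPoint, ofReal_exp, ← Complex.exp_add]
  congr 1; push_cast; ring

theorem exp_ofReal_mul_cpow_one_div {α : ℝ} {w : ℂ} (hα : α ≠ 0) (hw : |α * w.im| < Real.pi) :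
    cexp (α * w) ^ ((1 / α : ℝ) : ℂ) = cexp w := by
  have hb := abs_lt.1 hw
  rw [cpow_def_of_ne_zero (Complex.exp_ne_zero _), log_exp (by simpa using hb.1)
    (by simpa using hb.2.le)]
  have : (α : ℂ) ≠ 0 := by exact_mod_cast hα
  congr 1; push_cast; field_simp

/-- Here `|dζ| = α exp (α re w) |dw|`; the nonconstant factor lowers the index of the kernel by `α`.
-/
theorem exp_mul_absExpRoot {α : ℝ} {w : ℂ} (hα : α ≠ 0) (hw : |α * w.im| < Real.pi) :
    Real.exp (α * w.re) * absExpRoot α (cexp (α * w)) = ‖hankelKernel (1 - α) w‖ := by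
  rw [absExpRoot, exp_ofReal_mul_cpow_one_div hα hw, ← hankelKernel_mul_exp, norm_mul,
    norm_exp_ofReal_mul, hankelKernel]
  simp [mul_comm]

theorem exp_mul_absExpRootMul {α : ℝ} {w : ℂ} (hα : α ≠ 0) (hw : |α * w.im| < Real.pi) :
    Real.exp (α * w.re) * absExpRootMul α (cexp (α * w)) = ‖hankelKernel (-α) w‖ := by
  rw [absExpRootMul, exp_ofReal_mul_cpow_one_div hα hw, ← zero_sub, ← hankelKernel_mul_exp,
    norm_mul _ (cexp (α * w)), norm_exp_ofReal_mul, hankelKernel, ← Complex.exp_add]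
  simp [mul_comm]

/-- The substitution `ζ = exp (α w)` in the arc length integral over the contour `γ(1, θ)`. -/
theorem contourIntegrable_and_contourIntegral_eq {α φ : ℝ} {g : ℂ → ℝ} {F : ℂ → ℂ} (hα : 0 < α)
    (hφ : 0 ≤ φ) (hF : StripIntegrable 0 φ F)
    (h : ∀ w ∈ stripBoundary 0 φ, Real.exp (α * w.re) * g (cexp (α * w)) = ‖F w‖) :
    ContourIntegrable 1 (α * φ) g ∧
      contourIntegral 1 (α * φ) g = α * stripNormIntegral 0 φ F := by
  have him : (fun x : ℝ => Real.exp (α * x)) '' Ioi 0 = Ioi 1 := by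
    ext r
    simp only [mem_image, mem_Ioi]
    constructor
    · rintro ⟨x, hx, rfl⟩
      exact Real.one_lt_exp_iff.2 (mul_pos hα hx)
    · intro hr
      refine ⟨Real.log r / α, div_pos (Real.log_pos hr) hα, ?_⟩
      rw [mul_div_cancel₀ _ hα.ne', Real.exp_log (by linarith)]
  have hinj : InjOn (fun x : ℝ => Real.exp (α * x)) (Ioi 0) := fun x _ y _ hxy =>
    mul_left_cancel₀ hα.ne' (Real.exp_injective hxy)
  have hder : ∀ x ∈ Ioi (0 : ℝ), HasDerivWithinAt (fun x : ℝ => Real.exp (α * x))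
      (Real.exp (α * x) * (α * 1)) (Ioi 0) x := fun x _ =>
    (((hasDerivAt_id x).const_mul α).exp).hasDerivWithinAt
  have ray : ∀ y : ℝ, (∀ x : ℝ, 0 ≤ x → (x + y * I : ℂ) ∈ stripBoundary 0 φ) →
      IntegrableOn (fun x : ℝ => F (x + y * I)) (Ioi 0) →
      IntegrableOn (fun r : ℝ => g (polarPoint r (α * y))) (Ioi 1) ∧
        ∫ r in Ioi 1, g (polarPoint r (α * y)) = α * ∫ x in Ioi (0 : ℝ), ‖F (x + y * I)‖ := by
    intro y hy hFy
    have e : EqOn (fun x : ℝ => |Real.exp (α * x) * (α * 1)| •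
        g (polarPoint (Real.exp (α * x)) (α * y))) (fun x => α * ‖F (x + y * I)‖) (Ioi 0) := by
      intro x hx
      have hw := h _ (hy x (le_of_lt hx))
      simp only [add_re, ofReal_re, re_ofReal_mul, I_re, mul_zero, add_zero] at hw
      simp only [polarPoint_exp, smul_eq_mul]
      rw [← hw, abs_of_pos (by positivity)]
      ring
    have h1 := integrableOn_image_iff_integrableOn_abs_deriv_smul measurableSet_Ioi hder hinj
      (fun r : ℝ => g (polarPoint r (α * y)))
    have h2 := integral_image_eq_integral_abs_deriv_smul measurableSet_Ioi hder hinj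
      (fun r : ℝ => g (polarPoint r (α * y)))
    rw [him] at h1 h2
    rw [integrableOn_congr_fun e measurableSet_Ioi] at h1
    rw [setIntegral_congr_fun measurableSet_Ioi e, integral_const_mul] at h2
    exact ⟨h1.2 (hFy.norm.const_mul α), h2⟩
  have harc : EqOn (fun y : ℝ => g (polarPoint 1 (α * y)) * 1) (fun y => ‖F ((0 : ℝ) + y * I)‖)
      (uIcc (-φ) φ) := by
    intro y hy
    rw [uIcc_of_le (by linarith)] at hy
    have hw := h _ (segment_mem_stripBoundary (x₀ := 0) hy)
    have hp := polarPoint_exp α 0 y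
    rw [mul_zero, Real.exp_zero] at hp
    simp only [add_re, ofReal_re, re_ofReal_mul, I_re, mul_zero, add_zero, Real.exp_zero,
      one_mul] at hw
    simp only [hp, hw, mul_one]
  obtain ⟨i1, v1⟩ := ray φ (fun x hx => ray_mem_stripBoundary hφ hx) hF.1
  obtain ⟨i2, v2⟩ := ray (-φ) (fun x hx => ray_neg_mem_stripBoundary hφ hx) hF.2.1
  rw [mul_neg] at i2 v2
  have i3 : IntervalIntegrable (fun y : ℝ => g (polarPoint 1 (α * y)) * 1) volume (-φ) φ :=
    hF.2.2.norm.congr fun y hy => (harc (uIoc_subset_uIcc hy)).symm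
  have v3 : ∫ y in (-(α * φ))..(α * φ), g (polarPoint 1 y) * 1 =
      α * ∫ y : ℝ in (-φ)..φ, ‖F ((0 : ℝ) + y * I)‖ := by
    rw [← intervalIntegral.integral_congr harc, ← mul_neg]
    exact (intervalIntegral.mul_integral_comp_mul_left
      (f := fun y => g (polarPoint 1 y) * 1) α).symm
  refine ⟨⟨i2, ?_, i1⟩, ?_⟩
  · have := i3.comp_mul_left (c := α⁻¹)
    simp only [mul_inv_cancel_left₀ hα.ne', div_inv_eq_mul] at this
    rwa [neg_mul, mul_comm φ] at this
  · rw [contourIntegral, stripNormIntegral, v1, v2, v3]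
    ring

/-- With `ρ = ‖z‖`, the squared distance equals `(r - ρ cos θ₀)² + ρ² sin² θ₀ + 2rρ (cos θ₀ - cos (ψ
- arg z))`. Cosines, rather than angles, take care of the reduction modulo `2π`. -/
theorem norm_mul_sin_le_norm_polarPoint_sub {r ψ θ₀ : ℝ} {z : ℂ} (hr : 0 ≤ r)
    (h : Real.cos (ψ - arg z) ≤ Real.cos θ₀) :
    ‖z‖ * Real.sin θ₀ ≤ ‖polarPoint r ψ - z‖ := by
  refine abs_le_of_sq_le_sq' ?_ (norm_nonneg _) |>.2
  have hz1 : z.re = ‖z‖ * Real.cos (arg z) := (norm_mul_cos_arg z).symm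
  have hz2 : z.im = ‖z‖ * Real.sin (arg z) := (norm_mul_sin_arg z).symm
  have h1 : (polarPoint r ψ).re = r * Real.cos ψ := by
    simp [polarPoint, exp_re]
  have h2 : (polarPoint r ψ).im = r * Real.sin ψ := by
    simp [polarPoint, exp_im]
  rw [Complex.sq_norm, normSq_apply, sub_re, sub_im, h1, h2]
  have h3 := Real.sin_sq_add_cos_sq ψ
  have h4 := Real.sin_sq_add_cos_sq (arg z)
  have h5 := Real.sin_sq_add_cos_sq θ₀
  have h6 := mul_nonneg (mul_nonneg hr (norm_nonneg z)) (sub_nonneg.2 h)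
  rw [Real.cos_sub] at h6
  rw [hz1, hz2]
  have h7 := sq_nonneg (r - ‖z‖ * Real.cos θ₀)
  linear_combination 2 * h6 + h7 + ‖z‖ ^ 2 * h5 - r ^ 2 * h3 - ‖z‖ ^ 2 * h4

theorem cos_le_cos_of_le_of_le_two_pi_sub {x y : ℝ} (hy : 0 ≤ y) (h1 : y ≤ x)
    (h2 : x ≤ 2 * Real.pi - y) : Real.cos x ≤ Real.cos y := by
  rcases le_total x Real.pi with h | h
  · exact Real.cos_le_cos_of_nonneg_of_le_pi hy h h1
  · rw [← Real.cos_two_pi_sub x]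
    exact Real.cos_le_cos_of_nonneg_of_le_pi hy (by linarith) (by linarith)

/-- On the rays this is the separation of the angles. On the vertical side `‖exp (α w)‖ = 1`, and
`hz` says that `‖z‖ - 1 ≥ ‖z‖ sin θ₀`. -/
theorem norm_mul_sin_le_norm_exp_sub {α φ θ₀ : ℝ} {z w : ℂ}
    (h1 : Real.cos (α * φ - arg z) ≤ Real.cos θ₀) (h2 : Real.cos (α * φ + arg z) ≤ Real.cos θ₀)
    (hz : 1 ≤ ‖z‖ * (1 - Real.sin θ₀)) (hw : w ∈ stripBoundary 0 φ) :
    ‖z‖ * Real.sin θ₀ ≤ ‖cexp (α * w) - z‖ := by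
  rcases hw.2.2 with hre | him
  · have h3 : ‖cexp (α * w)‖ = 1 := by rw [norm_exp_ofReal_mul, hre, mul_zero, Real.exp_zero]
    have h4 := norm_sub_norm_le z (cexp (α * w))
    rw [norm_sub_rev, h3] at h4
    linarith
  · rw [← re_add_im w, ← polarPoint_exp]
    refine norm_mul_sin_le_norm_polarPoint_sub (Real.exp_pos _).le ?_
    rcases eq_or_eq_neg_of_abs_eq him with h | h
    · rwa [h]
    · rw [h, ← Real.cos_neg]
      convert h2 using 2
      ring

theorem norm_stripIntegral_mittagLefflerKernel_le {α β x₀ φ δ : ℝ} {z : ℂ}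
    (hφ : Real.pi / 2 < φ) (hφπ : φ ≤ Real.pi) (hδ : 0 < δ)
    (h : ∀ w ∈ stripBoundary x₀ φ, δ ≤ ‖cexp (α * w) - z‖) :
    ‖stripIntegral x₀ φ (mittagLefflerKernel α β z)‖ ≤
      δ⁻¹ * stripNormIntegral x₀ φ (hankelKernel (β - α)) := by
  refine norm_stripIntegral_le (by linarith [Real.pi_pos])
    (stripIntegrable_hankelKernel _ _ hφ hφπ) fun w hw => ?_
  rw [mittagLefflerKernel, hankelKernel_mul_exp, norm_div, div_eq_inv_mul]
  gcongr
  exact h w hw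

theorem stripIntegral_mittagLefflerKernel_self {α x₀ φ δ : ℝ} {z : ℂ} (hz : z ≠ 0)
    (hφ : Real.pi / 2 < φ) (hφπ : φ ≤ Real.pi) (hδ : 0 < δ)
    (h : ∀ w ∈ stripBoundary x₀ φ, δ ≤ ‖cexp (α * w) - z‖) :
    stripIntegral x₀ φ (mittagLefflerKernel α α z) =
      z⁻¹ * stripIntegral x₀ φ (mittagLefflerKernel α 0 z) := by
  rw [stripIntegral_congr (by linarith [Real.pi_pos])
    (G := fun w => -z⁻¹ * hankelKernel 0 w + z⁻¹ * mittagLefflerKernel α 0 z w),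
    stripIntegral_add ((stripIntegrable_hankelKernel _ _ hφ hφπ).const_mul _)
      ((stripIntegrable_mittagLefflerKernel hφ hφπ hδ h).const_mul _),
    stripIntegral_const_mul, stripIntegral_const_mul, stripIntegral_hankelKernel_zero hφ hφπ,
    mul_zero, zero_add]
  intro w hw
  have hne : cexp (α * w) - z ≠ 0 := norm_pos_iff.1 (hδ.trans_le (h w hw))
  have h1 := hankelKernel_mul_exp α α w
  rw [sub_self] at h1
  rw [mittagLefflerKernel, mittagLefflerKernel, h1]
  field_simp
  ring

/-- For `β = α` the leading term `-1/z` of `1/(ζ - z)` integrates to zero, which gains a factor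
`1/|z|`. -/
theorem norm_stripIntegral_mittagLefflerKernel_self_le {α x₀ φ δ : ℝ} {z : ℂ} (hz : z ≠ 0)
    (hφ : Real.pi / 2 < φ) (hφπ : φ ≤ Real.pi) (hδ : 0 < δ)
    (h : ∀ w ∈ stripBoundary x₀ φ, δ ≤ ‖cexp (α * w) - z‖) :
    ‖stripIntegral x₀ φ (mittagLefflerKernel α α z)‖ ≤
      (‖z‖ * δ)⁻¹ * stripNormIntegral x₀ φ (hankelKernel (-α)) := by
  rw [stripIntegral_mittagLefflerKernel_self hz hφ hφπ hδ h, norm_mul, norm_inv, mul_inv, mul_assoc]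
  gcongr
  simpa using norm_stripIntegral_mittagLefflerKernel_le (β := 0) hφ hφπ hδ h

theorem log_mul_rpow {α t : ℝ} {lam : ℂ} (ht : 0 < t) (hlam : lam ≠ 0) :
    log (lam * ((t ^ α : ℝ) : ℂ)) = log lam + α * log t := by
  rw [log_mul_ofReal _ (Real.rpow_pos_of_pos ht α) _ hlam, Real.log_rpow ht, add_comm]
  push_cast
  rw [ofReal_log ht.le]

/-- Evaluates the residue at the pole `w₀ = log z / α` for `z = λ t^α`, where `exp w₀ = λ^{1/α} t`.
-/
theorem hankelKernel_log_mul_rpow_div {α t : ℝ} (β : ℝ) {lam : ℂ} (hα : α ≠ 0) (ht : 0 < t)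
    (hlam : lam ≠ 0) :
    hankelKernel β (log (lam * ((t ^ α : ℝ) : ℂ)) / α) =
      cexp (lam ^ ((1 / α : ℝ) : ℂ) * t) * lam ^ (((1 - β) / α : ℝ) : ℂ) *
        ((t ^ (1 - β) : ℝ) : ℂ) := by
  have hαc : (α : ℂ) ≠ 0 := by exact_mod_cast hα
  have htc : (t : ℂ) ≠ 0 := by exact_mod_cast ht.ne'
  have h1 : cexp (log (lam * ((t ^ α : ℝ) : ℂ)) / α) = lam ^ ((1 / α : ℝ) : ℂ) * t := by
    have h2 : (log lam + α * log t) / α = log lam * ((1 / α : ℝ) : ℂ) + log t := by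
      push_cast; field_simp
    rw [log_mul_rpow ht hlam, cpow_def_of_ne_zero hlam, h2, Complex.exp_add, exp_log htc]
  rw [hankelKernel, h1, log_mul_rpow ht hlam, Complex.exp_add, mul_assoc]
  congr 1
  rw [cpow_def_of_ne_zero hlam, ofReal_cpow ht.le, cpow_def_of_ne_zero htc, ← Complex.exp_add]
  congr 1; push_cast; field_simp

theorem inv_le_norm_mul_rpow {α t s : ℝ} {lam : ℂ} (hα : 0 < α) (hlam : lam ≠ 0) (hs : 0 < 1 - s)
    (ht : 1 / (‖lam‖ ^ (1 / α) * (1 - s) ^ (1 / α)) ≤ t) : 1 ≤ ‖lam‖ * t ^ α * (1 - s) := by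
  have hl : 0 < ‖lam‖ := norm_pos_iff.2 hlam
  have h0 : 0 < ‖lam‖ ^ (1 / α) * (1 - s) ^ (1 / α) := by positivity
  rw [div_le_iff₀ h0] at ht
  have ht0 : 0 < t := pos_of_mul_pos_left (one_pos.trans_le ht) h0.le
  have h1 := Real.one_le_rpow ht hα.le
  rw [Real.mul_rpow ht0.le h0.le, Real.mul_rpow (by positivity) (by positivity),
    ← Real.rpow_mul hl.le, ← Real.rpow_mul hs.le, one_div_mul_cancel hα.ne', Real.rpow_one,
    Real.rpow_one] at h1
  linarith

end ArcLength

/-! ### The asymptotic estimates. -/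

theorem lemma2 (α θ θ₀ : ℝ) (lam : ℂ)
    (hα0 : 0 < α) (hα1 : α < 1) (hlam : lam ≠ 0)
    (hθ : θ ∈ Ioo (α * Real.pi / 2) (α * Real.pi))
    (hθ₀ : θ₀ ∈ Ioo 0 (θ - α * Real.pi / 2))
    (hsep : θ₀ ≤ |θ - abs (Complex.arg lam)|) :
    -- the integrals that define `m(α, λ)` converge
    (ContourIntegrable 1 θ (absExpRoot α) ∧ ContourIntegrable 1 θ (absExpRootMul α)) ∧
    -- (i)
    (|Complex.arg lam| < α * Real.pi / 2 → ∀ t : ℝ, tZero α θ₀ lam ≤ t →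
      ‖mittagLeffler α 1 (lam * ((t ^ α : ℝ) : ℂ))
          - 1 / (α : ℂ) * Complex.exp (lam ^ ((1 / α : ℝ) : ℂ) * (t : ℂ))‖
        ≤ mConst α θ θ₀ lam / t ^ α) ∧
    -- (ii)
    (|Complex.arg lam| < α * Real.pi / 2 → ∀ t : ℝ, tZero α θ₀ lam ≤ t →
      ‖((t ^ (α - 1) : ℝ) : ℂ) * mittagLeffler α (α : ℂ) (lam * ((t ^ α : ℝ) : ℂ))
          - 1 / (α : ℂ) * lam ^ ((1 / α - 1 : ℝ) : ℂ)
            * Complex.exp (lam ^ ((1 / α : ℝ) : ℂ) * (t : ℂ))‖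
        ≤ mConst α θ θ₀ lam / t ^ (α + 1)) ∧
    -- (iii)
    (θ < |Complex.arg lam| → |Complex.arg lam| ≤ Real.pi → ∀ t : ℝ, tZero α θ₀ lam ≤ t →
      ‖((t ^ (α - 1) : ℝ) : ℂ) * mittagLeffler α (α : ℂ) (lam * ((t ^ α : ℝ) : ℂ))‖
        ≤ mConst α θ θ₀ lam / t ^ (α + 1)) := by
  obtain ⟨φ, rfl⟩ : ∃ φ, θ = α * φ := ⟨θ / α, by field_simp⟩
  have hpi := Real.pi_pos
  have hφ : Real.pi / 2 < φ := by
    rw [← mul_lt_mul_iff_right₀ hα0]; linarith [hθ.1]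
  have hφπ : φ ≤ Real.pi := by
    rw [← mul_le_mul_iff_right₀ hα0]; linarith [hθ.2]
  have hφ0 : 0 ≤ φ := by linarith
  have hαπ : α * Real.pi < Real.pi := by nlinarith
  have hαφ : α * φ < Real.pi := hθ.2.trans hαπ
  have hθ₀half : θ₀ < Real.pi / 2 := by linarith [hθ₀.2, hθ.2]
  have hsin : 0 < Real.sin θ₀ := Real.sin_pos_of_pos_of_lt_pi hθ₀.1 (by linarith)
  have hsin1 : 0 < 1 - Real.sin θ₀ := by
    have := Real.sin_lt_sin_of_lt_of_le_pi_div_two (by linarith [hθ₀.1]) le_rfl hθ₀half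
    rw [Real.sin_pi_div_two] at this
    linarith
  have hl : 0 < ‖lam‖ := norm_pos_iff.2 hlam
  have hstrip : ∀ w ∈ stripBoundary 0 φ, |α * w.im| < Real.pi := fun w hw => by
    rw [abs_mul, abs_of_pos hα0]
    exact (mul_le_mul_of_nonneg_left hw.2.1 hα0.le).trans_lt hαφ
  obtain ⟨i1, v1⟩ := contourIntegrable_and_contourIntegral_eq hα0 hφ0
    (stripIntegrable_hankelKernel (1 - α) 0 hφ hφπ)
    fun w hw => exp_mul_absExpRoot hα0.ne' (hstrip w hw)
  obtain ⟨i2, v2⟩ := contourIntegrable_and_contourIntegral_eq hα0 hφ0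
    (stripIntegrable_hankelKernel (-α) 0 hφ hφπ)
    fun w hw => exp_mul_absExpRootMul hα0.ne' (hstrip w hw)
  have n1 := stripNormIntegral_nonneg (x₀ := 0) hφ0 (hankelKernel (1 - α))
  have n2 := stripNormIntegral_nonneg (x₀ := 0) hφ0 (hankelKernel (-α))
  have hm1 : stripNormIntegral 0 φ (hankelKernel (1 - α)) /
      (2 * Real.pi * ‖lam‖ * Real.sin θ₀) ≤ mConst α (α * φ) θ₀ lam := by
    refine le_trans (le_of_eq ?_) (le_max_left _ _)
    rw [v1]; field_simp
  have hm2 : stripNormIntegral 0 φ (hankelKernel (-α)) /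
      (2 * Real.pi * ‖lam‖ ^ 2 * Real.sin θ₀) ≤ mConst α (α * φ) θ₀ lam := by
    -- The contour argument gives an extra `π` in the denominator, which the constant in the
    -- statement does not have; it is discarded here.
    refine le_trans ?_ (le_max_right _ _)
    rw [v2, mul_assoc 2 α, mul_assoc 2, mul_left_comm 2 α, mul_assoc α, mul_div_mul_left _ _ hα0.ne',
      mul_comm Real.pi]
    gcongr
    nlinarith [Real.pi_gt_three, sq_nonneg ‖lam‖]
  have hnorm2pi : ‖(2 * Real.pi * Complex.I : ℂ)‖ = 2 * Real.pi := by
    simp [abs_of_pos hpi]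
  have h2pi : (2 * Real.pi * Complex.I : ℂ) ≠ 0 := by
    rw [← norm_pos_iff, hnorm2pi]; positivity
  -- Separation from the ray on the same side of the real axis as `λ`. The opposite ray, at angle `α
  -- φ + |arg λ|`, is handled case by case.
  have habs : Real.cos (α * φ - |Complex.arg lam|) ≤ Real.cos θ₀ := by
    rw [← Real.cos_abs (α * φ - _)]
    refine Real.cos_le_cos_of_nonneg_of_le_pi hθ₀.1.le ?_ hsep
    rw [abs_le]
    constructor <;>
      linarith [abs_nonneg (Complex.arg lam), Complex.abs_arg_le_pi lam, hθ.1, mul_nonneg hα0.le hφ0]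
  have bounds : ∀ t : ℝ, tZero α θ₀ lam ≤ t →
      Real.cos (α * φ + |Complex.arg lam|) ≤ Real.cos θ₀ →
      0 < t ∧ 1 ≤ ‖lam * ((t ^ α : ℝ) : ℂ)‖ * (1 - Real.sin θ₀) ∧
      ‖lam * ((t ^ α : ℝ) : ℂ)‖ = ‖lam‖ * t ^ α ∧
      Complex.arg (lam * ((t ^ α : ℝ) : ℂ)) = Complex.arg lam ∧
      ∀ w ∈ stripBoundary 0 φ, ‖lam‖ * t ^ α * Real.sin θ₀ ≤
        ‖Complex.exp (α * w) - lam * ((t ^ α : ℝ) : ℂ)‖ := by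
    intro t ht hcos
    have ht0 : 0 < t := by
      refine lt_of_lt_of_le ?_ ht
      unfold tZero; positivity
    have htα := Real.rpow_pos_of_pos ht0 α
    have hn : ‖lam * ((t ^ α : ℝ) : ℂ)‖ = ‖lam‖ * t ^ α := by
      rw [norm_mul, Complex.norm_real, Real.norm_eq_abs, abs_of_pos htα]
    have ha : Complex.arg (lam * ((t ^ α : ℝ) : ℂ)) = Complex.arg lam :=
      Complex.arg_mul_real htα lam
    have h1 : 1 ≤ ‖lam * ((t ^ α : ℝ) : ℂ)‖ * (1 - Real.sin θ₀) := by
      rw [hn]; exact inv_le_norm_mul_rpow hα0 hlam hsin1 ht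
    refine ⟨ht0, h1, hn, ha, fun w hw => ?_⟩
    rw [← hn]
    refine norm_mul_sin_le_norm_exp_sub ?_ ?_ h1 hw <;> rw [ha] <;>
      rcases abs_choice (Complex.arg lam) with h | h <;> rw [h] at habs hcos <;>
      first | assumption | simpa using habs
  -- The error bound for `β = α`, common to (ii) and (iii): `t^{α-1} / |z|²` yields `t^{-α-1}`.
  have second : ∀ t : ℝ, 0 < t → (∀ w ∈ stripBoundary 0 φ, ‖lam‖ * t ^ α * Real.sin θ₀ ≤
        ‖Complex.exp (α * w) - lam * ((t ^ α : ℝ) : ℂ)‖) →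
      ‖((t ^ (α - 1) : ℝ) : ℂ) * (stripIntegral 0 φ
        (mittagLefflerKernel α α (lam * ((t ^ α : ℝ) : ℂ))) / (2 * Real.pi * Complex.I))‖ ≤
      mConst α (α * φ) θ₀ lam / t ^ (α + 1) := by
    intro t ht hδ
    have htα := Real.rpow_pos_of_pos ht α
    have hz : lam * ((t ^ α : ℝ) : ℂ) ≠ 0 := mul_ne_zero hlam (by exact_mod_cast htα.ne')
    have hb := norm_stripIntegral_mittagLefflerKernel_self_le hz hφ hφπ (by positivity) hδ
    rw [norm_mul, norm_div, hnorm2pi, Complex.norm_real, Real.norm_eq_abs,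
      abs_of_pos (Real.rpow_pos_of_pos ht _)]
    rw [norm_mul, Complex.norm_real, Real.norm_eq_abs, abs_of_pos htα] at hb
    refine le_trans ?_ (div_le_div_of_nonneg_right hm2 (Real.rpow_pos_of_pos ht _).le)
    calc _ ≤ t ^ (α - 1) * (((‖lam‖ * t ^ α * (‖lam‖ * t ^ α * Real.sin θ₀))⁻¹ *
          stripNormIntegral 0 φ (hankelKernel (-α))) / (2 * Real.pi)) := by gcongr
      _ = _ := by
        rw [Real.rpow_sub_one ht.ne', Real.rpow_add_one ht.ne']
        field_simp
  -- `α φ + |arg λ| + θ₀ < 2 α φ < 2π`, because `|arg λ| < απ/2` and `θ₀ < α φ - απ/2`.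
  have right_cos : |Complex.arg lam| < α * Real.pi / 2 →
      Real.cos (α * φ + |Complex.arg lam|) ≤ Real.cos θ₀ := fun h =>
    cos_le_cos_of_le_of_le_two_pi_sub hθ₀.1.le
      (by linarith [hθ₀.2, abs_nonneg (Complex.arg lam), mul_pos hα0 hpi])
      (by linarith [hθ₀.2, hθ.2])
  have repr : ∀ β t : ℝ, 0 < β → |Complex.arg lam| < α * Real.pi / 2 → tZero α θ₀ lam ≤ t →
      mittagLeffler α β (lam * ((t ^ α : ℝ) : ℂ)) - 1 / (α : ℂ) *
        hankelKernel β (Complex.log (lam * ((t ^ α : ℝ) : ℂ)) / α) =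
      stripIntegral 0 φ (mittagLefflerKernel α β (lam * ((t ^ α : ℝ) : ℂ))) /
        (2 * Real.pi * Complex.I) := by
    intro β t hβ h ht
    obtain ⟨ht0, h1, hn, ha, hδ⟩ := bounds t ht (right_cos h)
    have htα := Real.rpow_pos_of_pos ht0 α
    rw [stripIntegral_mittagLefflerKernel_of_abs_arg_lt hα0 hβ hφ hφπ (by positivity) hδ hαφ
      (by rw [ha]; exact h.trans hθ.1), mul_div_cancel_left₀ _ h2pi]
    -- The pole lies to the right of the vertical side: `‖z‖ > 1` follows from `h1` and `sin θ₀ >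
    -- 0`.
    rw [mul_zero, Real.exp_zero]
    nlinarith [norm_nonneg (lam * ((t ^ α : ℝ) : ℂ))]
  refine ⟨⟨i1, i2⟩, fun h t ht => ?_, fun h t ht => ?_, fun h _ t ht => ?_⟩
  · obtain ⟨ht0, h1, hn, ha, hδ⟩ := bounds t ht (right_cos h)
    have htα := Real.rpow_pos_of_pos ht0 α
    have hr := repr 1 t one_pos h ht
    rw [hankelKernel_log_mul_rpow_div 1 hα0.ne' ht0 hlam] at hr
    simp only [sub_self, zero_div, Complex.ofReal_zero, Complex.cpow_zero, Real.rpow_zero,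
      Complex.ofReal_one, mul_one] at hr
    rw [hr, norm_div, hnorm2pi]
    refine le_trans ?_ (div_le_div_of_nonneg_right hm1 htα.le)
    calc _ ≤ (‖lam‖ * t ^ α * Real.sin θ₀)⁻¹ *
          stripNormIntegral 0 φ (hankelKernel (1 - α)) / (2 * Real.pi) := by
          gcongr
          exact norm_stripIntegral_mittagLefflerKernel_le hφ hφπ (by positivity) hδ
      _ = _ := by field_simp
  · obtain ⟨ht0, h1, hn, ha, hδ⟩ := bounds t ht (right_cos h)
    have hr := repr α t hα0 h ht
    rw [hankelKernel_log_mul_rpow_div α hα0.ne' ht0 hlam] at hr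
    refine le_trans (le_of_eq ?_) (second t ht0 hδ)
    rw [← hr]
    have hpow : ((t ^ (α - 1) : ℝ) : ℂ) * ((t ^ (1 - α) : ℝ) : ℂ) = 1 := by
      rw [← Complex.ofReal_mul, ← Real.rpow_add ht0]; simp
    have hexp : (1 - α) / α = 1 / α - 1 := by field_simp
    rw [hexp]
    congr 1
    linear_combination (1 / (α : ℂ) * Complex.exp (lam ^ ((1 / α : ℝ) : ℂ) * t) *
      lam ^ ((1 / α - 1 : ℝ) : ℂ)) * hpow
  · have hs' : θ₀ ≤ |Complex.arg lam| - α * φ := by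
      rwa [abs_sub_comm, abs_of_pos (sub_pos.2 h)] at hsep
    obtain ⟨ht0, h1, hn, ha, hδ⟩ := bounds t ht (cos_le_cos_of_le_of_le_two_pi_sub hθ₀.1.le
      (by linarith [mul_nonneg hα0.le hφ0]) (by linarith [Complex.abs_arg_le_pi lam]))
    have htα := Real.rpow_pos_of_pos ht0 α
    have hr := stripIntegral_mittagLefflerKernel_of_lt_abs_arg (β := α) hα0 hα0 hφ hφπ
      (by positivity) hδ hαφ (by rwa [ha])
    refine le_trans (le_of_eq ?_) (second t ht0 hδ)
    rw [hr, mul_div_cancel_left₀ _ h2pi]
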